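/- Let $n\ge 1$ be an integer. A sequence $c=(c_k)_{k\ge1}$ of nonnegative reals is called an equilibrium (with parameter $n$) if $\sum_{k\ge1}k c_k=1$ and, with $m_0(c)=\sum_{k\ge1}c_k$, $$\Big(2+\frac{k-1}{n}\Big)c_k=\frac1{m_0(c)}\sum_{i=1}^{k-1}c_i\,c_{k-i}\qquad(k\ge2).$$ Let $(G(i))_{i\ge0}$ be i.i.d. Galton–Watson trees with offspring distribution $\frac12(\delta_0+\delta_2)$. The size-biased critical binary Galton–Watson tree $\widehat G$ is the rooted tree consisting of an infinite backbone $x_0,x_1,x_2,\dots$ (where $x_0$ is the root), in which each $x_i$ has exactly two children: $x_{i+1}$ and the root of $G(i)$. An extra vertex $\star$ is joined to the root by an edge; $\star$ is not a leaf. Pruning of a tree $T$: conditionally on $T$, give the edges (including the one at $\star$) i.i.d. lengths with exponential law of parameter $2$. Given these, for every internal vertex $x$ of $T$ let $\pi_x$ be a Poisson point process of marks with rate $1/n$ (for the length) on the branch joining $\star$ to $x$, these processes being independent. Explore the tree from the top down to $\star$, i.e. by decreasing distance to $\star$. Each time an active mark is met, remove the whole subtree above it, replace it by a leaf, and deactivate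 all the marks sent by internal vertices of this subtree (all marks are active at the beginning; the marks which generate a removal are called useful). The resulting tree is $\mathcal P_n(T)$. For an infinite tree, this is understood as follows: a set $U$ of marks is admissible if a mark belongs to $U$ if and only if it is not deactivated by a mark of $U$ lying farther from $\star$; the procedure is well defined if there is exactly one admissible set, which is then the set of useful marks. Then: 1. Almost surely, the procedure is well defined for $T=\widehat G$, and $\mathcal P_n(\widehat G)$ is finite. 2. (Perfect simulation.) Almost surely, there is some $j\ge0$ such that $\pi_{x_j}$ has a mark in the edge just below $x_j$. Almost surely, for every such $j$, the tree obtained from $\widehat G$ by removing everything strictly above $x_j$ (so that $x_j$ becomes a leaf) is finite, and the same procedure, with the same edge lengths and the same processes at the remaining internal vertices, is well defined on this finite tree and yields $\mathcal P_n(\widehat G)$. 3. There is exactly one equilibrium $c^n=(c^n_k)_{k\ge1}$ with parameter $n$, and the number $|L(\mathcal P_n(\widehat G))|$ of leaves of $\mathcal P_n(\widehat G)$ satisfies $$\Pr\big(|L(\mathcal P_n(\widehat G))|=k\big)=k\,c^n_k\qquad\text{for all }k\ge1 .$$ -/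

import Mathlib

open MeasureTheory ProbabilityTheory
open scoped NNReal

namespace ForestFire

/-! ### The equilibrium equation -/

/-- `m₀(c) = ∑_{k ≥ 1} c_k`. -/
noncomputable def m₀ (c : ℕ → ℝ) : ℝ := ∑' k, c k

/-- `c = (c_k)_{k ≥ 1}` is an equilibrium of the coagulation-fragmentation system with parameter
`n` and total mass `1`. Sequences are indexed by `ℕ` with the convention `c 0 = 0`. -/
structure IsEquilibrium (n : ℕ) (c : ℕ → ℝ) : Prop where
  zero : c 0 = 0
  nonneg : ∀ k, 0 ≤ c k
  mass : HasSum (fun k : ℕ => (k : ℝ) * c k) 1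
  eqn : ∀ k : ℕ, 2 ≤ k →
    (2 + ((k : ℝ) - 1) / n) * c k = 1 / m₀ c * ∑ i ∈ Finset.Ico 1 k, c i * c (k - i)

/-! ### Rooted trees

Vertices are words of natural numbers: `[]` is the root `∅` and `v ++ [j]` is the `j`-th child
of `v`. A tree is a prefix-closed set of words containing `[]`. The additional vertex `⋆` below
the root is not represented. The edge just below `v` (joining `v` to its parent, or `∅` to `⋆`)
is identified with `v`. -/

abbrev Vertex := List ℕ

/-- The leaves of `T`: the vertices without children. -/
def leaves (T : Set Vertex) : Set Vertex := {v | v ∈ T ∧ ∀ j : ℕ, v ++ [j] ∉ T}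

/-- The internal vertices (nodes) of `T`. -/
def nodes (T : Set Vertex) : Set Vertex := {v | v ∈ T ∧ ∃ j : ℕ, v ++ [j] ∈ T}

/-- The Galton-Watson tree in which the vertex `u` has `ν u` children. -/
def galtonWatson (ν : Vertex → ℕ) : Set Vertex :=
  {v | ∀ (u : Vertex) (j : ℕ), u ++ [j] <+: v → j < ν u}

/-- The `i`-th vertex of the backbone, `i = 0, 1, 2, …`; the `0`-th one is the root. -/
def spine (i : ℕ) : Vertex := List.replicate i 1

/-- An infinite backbone, with the tree `G i` planted on its `i`-th vertex: that vertex has two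
children, the next vertex of the backbone (child `1`) and the root of `G i` (child `0`). -/
def backboneTree (G : ℕ → Set Vertex) : Set Vertex :=
  {v | ∃ i, v = spine i} ∪ {v | ∃ i, ∃ w ∈ G i, v = spine i ++ 0 :: w}

/-! ### Edge lengths, marks and pruning -/

/-- The distance from `⋆` to `v` when each edge `e` has length `κ e`. -/
noncomputable def height (κ : Vertex → ℝ) (v : Vertex) : ℝ :=
  ∑ i ∈ Finset.range (v.length + 1), κ (v.take i)

/-- The distance from `⋆` to the lower endpoint of the edge `v`, i.e. to the parent of `v`. -/
noncomputable def bottom (κ : Vertex → ℝ) (v : Vertex) : ℝ :=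
  ∑ i ∈ Finset.range v.length, κ (v.take i)

/-- A mark `(x, h)` is sent by the node `x` and lies at distance `h` from `⋆` on the branch
joining `⋆` to `x`. -/
abbrev Mark := Vertex × ℝ

/-- The mark `m` lies in the edge `y`; in particular `y` is an edge of the branch from `⋆` to the
node which sends `m`. -/
def InEdge (κ : Vertex → ℝ) (m : Mark) (y : Vertex) : Prop :=
  y <+: m.1 ∧ bottom κ y < m.2 ∧ m.2 < height κ y

/-- The marks on `T`: each node `x` sends the points of `π x ⊆ (0, ∞)` that fall on the branch
from `⋆` to `x`, which is identified with `(0, height κ x)` through the distance to `⋆`. -/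
def marks (T : Set Vertex) (κ : Vertex → ℝ) (π : Vertex → Set ℝ) : Set Mark :=
  {m | m.1 ∈ nodes T ∧ m.2 ∈ π m.1 ∧ ∃ y, InEdge κ m y}

/-- If a pruning takes place at `m'`, then it deactivates `m`: going down the tree, `m'` is met
before `m`, and the node sending `m` belongs to the subtree above `m'`. -/
def Deactivates (κ : Vertex → ℝ) (m' m : Mark) : Prop :=
  m.2 < m'.2 ∧ ∃ y, InEdge κ m' y ∧ y <+: m.1

/-- `U` is a possible outcome (as the set of useful marks) of the exploration of the tree from
its top down to `⋆`: a mark generates a pruning if and only if no pruning met before has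
deactivated it. -/
def IsUsefulSet (T : Set Vertex) (κ : Vertex → ℝ) (π : Vertex → Set ℝ) (U : Set Mark) : Prop :=
  ∀ m, m ∈ U ↔ m ∈ marks T κ π ∧ ∀ m' ∈ U, ¬ Deactivates κ m' m

/-- The pruning procedure makes sense: its rule determines the set of useful marks. -/
def PruningWellDefined (T : Set Vertex) (κ : Vertex → ℝ) (π : Vertex → Set ℝ) : Prop :=
  ∃! U, IsUsefulSet T κ π U

/-- The set of useful marks (meaningful if `PruningWellDefined T κ π`: it is then the only
set `U` such that `IsUsefulSet T κ π U`). -/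
def useful (T : Set Vertex) (κ : Vertex → ℝ) (π : Vertex → Set ℝ) : Set Mark :=
  ⋃₀ {U | IsUsefulSet T κ π U}

/-- The pruned tree: what lies above a useful mark is removed and replaced by a leaf. If the mark
lies in the edge `y`, this leaf is called `y`, and the strict descendants of `y` are removed. -/
def prune (T : Set Vertex) (κ : Vertex → ℝ) (π : Vertex → Set ℝ) : Set Vertex :=
  {v | v ∈ T ∧ ∀ m ∈ useful T κ π, ∀ y, InEdge κ m y → y <+: v → y = v}

/-- The subtree of `T` in which everything strictly above `x` is removed (`x` becomes a leaf). -/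
def truncate (T : Set Vertex) (x : Vertex) : Set Vertex := {v | v ∈ T ∧ (x <+: v → x = v)}

/-! ### Poisson point processes and independence -/

/-- The random set `N` is a (homogeneous) Poisson point process with rate `r` on `(0, ∞)`. -/
structure IsPoissonPointProcess {Ω : Type*} [MeasurableSpace Ω] (P : Measure Ω) (r : ℝ≥0)
    (N : Ω → Set ℝ) : Prop where
  measurable_count : ∀ B : Set ℝ, MeasurableSet B → B ⊆ Set.Ioi 0 →
    Measurable fun ω => (N ω ∩ B).encard
  count_law : ∀ B : Set ℝ, MeasurableSet B → B ⊆ Set.Ioi 0 → volume B ≠ ⊤ →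
    ∀ k : ℕ, P {ω | (N ω ∩ B).encard = k} = poissonMeasure (r * (volume B).toNNReal) {k}
  count_indep : ∀ B : ℕ → Set ℝ, (∀ i, MeasurableSet (B i)) → (∀ i, B i ⊆ Set.Ioi 0) →
    (∀ i, volume (B i) ≠ ⊤) → Pairwise (fun i j => Disjoint (B i) (B j)) →
    iIndepFun (fun i ω => (N ω ∩ B i).encard) P

/-- The `σ`-algebra generated by a random set of points in `(0, ∞)`, through its counts. -/
@[reducible] noncomputable def pointSigma {Ω : Type*} (N : Ω → Set ℝ) : MeasurableSpace Ω :=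
  ⨆ (B : Set ℝ) (_ : MeasurableSet B) (_ : B ⊆ Set.Ioi 0),
    MeasurableSpace.comap (fun ω => (N ω ∩ B).encard) ⊤

/-- The family of the `σ`-algebras generated by each offspring number `ν i v`, each edge length
`κ v` and each point process `π v`. -/
@[reducible] noncomputable def inputSigma {Ω : Type*} (ν : ℕ → Vertex → Ω → ℕ) (κ : Vertex → Ω → ℝ)
    (π : Vertex → Ω → Set ℝ) : (ℕ × Vertex) ⊕ (Vertex ⊕ Vertex) → MeasurableSpace Ω
  | .inl p => MeasurableSpace.comap (ν p.1 p.2) inferInstance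
  | .inr (.inl v) => MeasurableSpace.comap (κ v) inferInstance
  | .inr (.inr v) => pointSigma (π v)

/-- `(ν, κ, π)` are the random objects used to build and prune a size-biased binary critical
Galton-Watson tree: offspring numbers `ν i v` with law `(δ₀ + δ₂) / 2` (those of the `i`-th
planted tree), edge lengths `κ v` with the exponential law of parameter `2`, and Poisson point
processes `π v` with rate `1 / n`, all mutually independent. -/
structure IsInput {Ω : Type*} [MeasurableSpace Ω] (P : Measure Ω) (n : ℕ)
    (ν : ℕ → Vertex → Ω → ℕ) (κ : Vertex → Ω → ℝ) (π : Vertex → Ω → Set ℝ) : Prop where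
  measurable_offspring : ∀ i v, Measurable (ν i v)
  offspring_zero : ∀ i v, P {ω | ν i v ω = 0} = 1 / 2
  offspring_two : ∀ i v, P {ω | ν i v ω = 2} = 1 / 2
  measurable_length : ∀ v, Measurable (κ v)
  length_law : ∀ v, P.map (κ v) = expMeasure 2
  poisson : ∀ v, IsPoissonPointProcess P (1 / (n : ℝ≥0)) (π v)
  indep : iIndep (inputSigma ν κ π) P

/-- The size-biased binary critical Galton-Watson tree. -/
def sizeBiasedTree {Ω : Type*} (ν : ℕ → Vertex → Ω → ℕ) (ω : Ω) : Set Vertex :=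
  backboneTree fun i => galtonWatson fun v => ν i v ω

/-- The pruned size-biased binary critical Galton-Watson tree. -/
def prunedTree {Ω : Type*} (ν : ℕ → Vertex → Ω → ℕ) (κ : Vertex → Ω → ℝ)
    (π : Vertex → Ω → Set ℝ) (ω : Ω) : Set Vertex :=
  prune (sizeBiasedTree ν ω) (fun v => κ v ω) (fun v => π v ω)

/-- The vertex `spine j` sends a mark to the edge just below it. -/
def HasOwnMark {Ω : Type*} (κ : Vertex → Ω → ℝ) (π : Vertex → Ω → Set ℝ) (ω : Ω) (j : ℕ) : Prop :=
  ∃ h ∈ π (spine j) ω, InEdge (fun v => κ v ω) (spine j, h) (spine j)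

end ForestFire

namespace ForestFire

/-!
Only the marks sent by nodes that are still alive matter, and a mark of `x` on the edge just below
`x` shields everything below it from what lies above `x`. Such a mark almost surely occurs
infinitely often along the backbone, so the pruning is decided on finite trees, recursively: the
nodes alive above an edge are those alive above the two edges on top of it together with the node
between them, and all of them are removed if one of them sends a mark to the edge.

Given that `k` nodes are alive above an edge of exponential length, they send it no mark with
probability `2 / (2 + k / n)`. Hence the law `p` of the number of alive nodes of a planted
Galton-Watson tree satisfies `(2 + (k + 1) / n) p_{k+1} = ∑ p_i p_{k-i}`, which is the equilibrium
equation for `c_{k+1} / m₀(c)`, and the law `s` of the number of alive nodes of the size-biased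
tree satisfies `(2 + (k + 1) / n) s_{k+1} = 2 ∑ p_i s_{k-i}`, which the size-biasing
`s_k ∝ (k + 1) p_k` solves. Both equations determine their solution, because it is monotone in the
mass at `0` and has total mass `1`. Finally, a finite binary tree has one more leaf than it has
nodes.
-/

/-! ### Kernels of relations -/

section Kernel

variable {α : Type*} {D : α → α → Prop} {M M' U : Set α} {m m₀ : α}

/-- `U` is a kernel of the relation `D` on `M`: a point of `M` belongs to `U` exactly when no point
of `U` is related to it. The sets of useful marks are the kernels of `Deactivates κ` on the set of
marks. -/
def IsKernel (D : α → α → Prop) (M U : Set α) : Prop :=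
  ∀ m, m ∈ U ↔ m ∈ M ∧ ∀ m' ∈ U, ¬ D m' m

/-- The point `m₀`, as well as everything which is related to it, is related to `m`; such a point
`m` plays no role in the kernels of `D`. -/
def Dominates (D : α → α → Prop) (m₀ m : α) : Prop := D m₀ m ∧ ∀ m', D m' m₀ → D m' m

lemma IsKernel.subset (hU : IsKernel D M U) : U ⊆ M := fun m hm => ((hU m).1 hm).1

lemma IsKernel.not_rel (hU : IsKernel D M U) {m' : α} (hm' : m' ∈ U) (hm : m ∈ U) : ¬ D m' m :=
  ((hU m).1 hm).2 m' hm'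

lemma IsKernel.exists_rel_of_dominates (hU : IsKernel D M U) (h₀ : m₀ ∈ M)
    (h : Dominates D m₀ m) : ∃ m' ∈ U, D m' m := by
  by_cases hmem : m₀ ∈ U
  · exact ⟨m₀, hmem, h.1⟩
  · rw [hU m₀] at hmem
    push Not at hmem
    obtain ⟨m', hm', hD⟩ := hmem h₀
    exact ⟨m', hm', h.2 m' hD⟩

lemma IsKernel.notMem_of_dominates (hU : IsKernel D M U) (h₀ : m₀ ∈ M) (h : Dominates D m₀ m) :
    m ∉ U := fun hm =>
  have ⟨_, hm', hD⟩ := hU.exists_rel_of_dominates h₀ h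
  hU.not_rel hm' hm hD

lemma isKernel_iff_of_dominates (hM' : M' ⊆ M)
    (h : ∀ m ∈ M, m ∉ M' → ∃ m₀ ∈ M', Dominates D m₀ m) : IsKernel D M U ↔ IsKernel D M' U := by
  constructor <;> intro hU m
  · rw [hU m]
    refine and_congr_left fun hD => ⟨fun hm => ?_, fun hm => hM' hm⟩
    by_contra hm'
    obtain ⟨m₀, h₀, hdom⟩ := h m hm hm'
    exact hU.notMem_of_dominates (hM' h₀) hdom ((hU m).2 ⟨hm, hD⟩)
  · rw [hU m]
    refine and_congr_left fun hD => ⟨fun hm => hM' hm, fun hm => ?_⟩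
    by_contra hm'
    obtain ⟨m₀, h₀, hdom⟩ := h m hm hm'
    obtain ⟨m', hm'U, hD'⟩ := hU.exists_rel_of_dominates h₀ hdom
    exact hD m' hm'U hD'

lemma IsKernel.inter (hU : IsKernel D M U) (hM' : M' ⊆ M)
    (h : ∀ a ∈ U, ∀ b ∈ M', D a b → a ∈ M') : IsKernel D M' (U ∩ M') := by
  intro m
  rw [Set.mem_inter_iff, and_comm]
  refine and_congr_right fun hm => (hU m).trans ?_
  simp only [hM' hm, true_and]
  exact ⟨fun hD m' hm' => hD m' hm'.1, fun hD m' hm' hrel => hD m' ⟨hm', h m' hm' m hm hrel⟩ hrel⟩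

theorem existsUnique_isKernel (hwf : M.WellFoundedOn D) : ∃! U, IsKernel D M U := by
  obtain ⟨K, hK⟩ : ∃ K : M → Prop, ∀ b, K b ↔ ∀ a : M, D a b → ¬ K a :=
    ⟨hwf.fix fun b F => ∀ (a : M) (h : D a b), ¬ F a h, fun b => by rw [hwf.fix_eq]⟩
  refine ⟨{m | ∃ h : m ∈ M, K ⟨m, h⟩}, fun m => ?_, fun W hW => ?_⟩
  · constructor
    · rintro ⟨hm, hk⟩
      exact ⟨hm, fun m' ⟨hm', hk'⟩ hD => (hK _).1 hk ⟨m', hm'⟩ hD hk'⟩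
    · rintro ⟨hm, h⟩
      exact ⟨hm, (hK _).2 fun a hD hk => h a ⟨a.2, hk⟩ hD⟩
  · have key : ∀ b : M, (b : α) ∈ W ↔ K b := fun b => by
      induction b using WellFounded.induction hwf with
      | _ b ih =>
        rw [hW, hK]
        exact ⟨fun h a hD hk => h.2 a ((ih a hD).2 hk) hD,
          fun h => ⟨b.2, fun a ha hD => h ⟨a, hW.subset ha⟩ hD ((ih ⟨a, hW.subset ha⟩ hD).1 ha)⟩⟩
    ext m
    exact ⟨fun hm => ⟨hW.subset hm, (key ⟨m, hW.subset hm⟩).1 hm⟩,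
      fun ⟨hm, hk⟩ => (key ⟨m, hm⟩).2 hk⟩

lemma wellFoundedOn_of_forall_exists_finite {β : Type*} [Preorder β] (f : α → β)
    (hf : ∀ a b, D a b → f b < f a)
    (h : ∀ m ∈ M, ∃ F : Set α, F.Finite ∧ m ∈ F ∧ ∀ a ∈ M, ∀ b ∈ M, D a b → b ∈ F → a ∈ F) :
    M.WellFoundedOn D := by
  refine wellFounded_iff_isEmpty_descending_chain.2 ⟨fun ⟨u, hu⟩ => ?_⟩
  obtain ⟨F, hfin, h0, hF⟩ := h _ (u 0).2
  have hmono : StrictMono fun k => f (u k) := strictMono_nat_of_lt_succ fun k => hf _ _ (hu k)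
  have hmem : ∀ k, (u k : α) ∈ F := fun k => by
    induction k with
    | zero => exact h0
    | succ k ih => exact hF _ (u (k + 1)).2 _ (u k).2 (hu k) ih
  have hinj : Function.Injective fun k => (u k : α) := fun i j hij =>
    hmono.injective (congrArg f hij)
  exact Set.infinite_of_injective_forall_mem hinj hmem hfin

end Kernel

/-! ### Binary trees -/

/-- `T` is the binary tree in which the vertex `v` has `N v ∈ {0, 2}` children; the values of `N`
outside of `T` are irrelevant, but are also required to be `0` or `2`. -/
structure IsBinary (T : Set Vertex) (N : Vertex → ℕ) : Prop where
  root : [] ∈ T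
  child : ∀ v j, v ++ [j] ∈ T ↔ v ∈ T ∧ j < N v
  two : ∀ v, N v = 0 ∨ N v = 2

/-- Every branch going up from `v` meets a vertex satisfying `Q` within `d` steps. -/
def Terminates (Q : Vertex → Prop) : ℕ → Vertex → Prop
  | 0, v => Q v
  | d + 1, v => Q v ∨ (Terminates Q d (v ++ [0]) ∧ Terminates Q d (v ++ [1]))

section Terminates

variable {Q Q' : Vertex → Prop} {d d' : ℕ} {v : Vertex}

lemma Terminates.succ (h : Terminates Q d v) : Terminates Q (d + 1) v := by
  induction d generalizing v with
  | zero => exact Or.inl h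
  | succ d ih => exact h.imp id fun h => ⟨ih h.1, ih h.2⟩

lemma Terminates.of_le (hd : d ≤ d') (h : Terminates Q d v) : Terminates Q d' v := by
  induction hd with
  | refl => exact h
  | step _ ih => exact ih.succ

lemma Terminates.mono (hQ : ∀ v, Q v → Q' v) (h : Terminates Q d v) : Terminates Q' d v := by
  induction d generalizing v with
  | zero => exact hQ _ h
  | succ d ih => exact h.imp (hQ _) fun h => ⟨ih h.1, ih h.2⟩

end Terminates

namespace IsBinary

variable {T : Set Vertex} {N : Vertex → ℕ} {v w x : Vertex} {j : ℕ}

lemma mem_of_append (hT : IsBinary T N) (h : v ++ w ∈ T) : v ∈ T := by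
  induction w using List.reverseRecOn with
  | nil => simpa using h
  | append_singleton w j ih =>
    rw [← List.append_assoc, hT.child] at h
    exact ih h.1

lemma mem_nodes (hT : IsBinary T N) : v ∈ nodes T ↔ v ∈ T ∧ N v = 2 := by
  refine and_congr_right fun hv => ⟨fun ⟨j, hj⟩ => ?_, fun h2 => ⟨0, ?_⟩⟩
  · have := ((hT.child v j).1 hj).2
    exact (hT.two v).resolve_left (by omega)
  · exact (hT.child v 0).2 ⟨hv, by omega⟩

lemma concat_mem (hT : IsBinary T N) : v ++ [j] ∈ T ↔ v ∈ nodes T ∧ j < 2 := by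
  rw [hT.child, hT.mem_nodes]
  have := hT.two v
  constructor <;> rintro ⟨h, hj⟩
  · exact ⟨⟨h, by omega⟩, by omega⟩
  · exact ⟨h.1, by omega⟩

lemma mem_nodes_of_append_cons (hT : IsBinary T N) (h : v ++ j :: w ∈ T) : v ∈ nodes T ∧ j < 2 := by
  rw [List.append_cons] at h
  exact hT.concat_mem.1 (hT.mem_of_append h)

lemma mem_nodes_of_append_mem_nodes (hT : IsBinary T N) (h : v ++ w ∈ nodes T) : v ∈ nodes T := by
  rcases w with _ | ⟨j, w⟩
  · simpa using h
  · exact (hT.mem_nodes_of_append_cons h.1).1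

lemma eq_insert_image (hT : IsBinary T N) :
    T = insert [] ((fun p : Vertex × ℕ => p.1 ++ [p.2]) '' (nodes T ×ˢ Set.Iio 2)) := by
  ext w
  induction w using List.reverseRecOn with
  | nil => simp [hT.root]
  | append_singleton w j _ => simp [hT.concat_mem]

lemma finite_of_finite_nodes (hT : IsBinary T N) (h : (nodes T).Finite) : T.Finite := by
  rw [hT.eq_insert_image]
  exact ((h.prod (Set.finite_Iio 2)).image _).insert _

lemma ncard_leaves (hT : IsBinary T N) (h : (nodes T).Finite) :
    (leaves T).ncard = (nodes T).ncard + 1 := by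
  have hinj : Function.Injective fun p : Vertex × ℕ => p.1 ++ [p.2] := fun p q hpq => by
    simpa [Prod.ext_iff] using hpq
  have hcard : T.ncard = 2 * (nodes T).ncard + 1 := by
    conv_lhs => rw [hT.eq_insert_image]
    rw [Set.ncard_insert_of_notMem (by simp) ((h.prod (Set.finite_Iio 2)).image _),
      Set.ncard_image_of_injective _ hinj, Set.ncard_prod, mul_comm]
    simp
  have hleaves : leaves T = T \ nodes T := by
    ext v
    simp [leaves, nodes]
  have hsub : nodes T ⊆ T := fun v hv => hv.1
  rw [hleaves, Set.ncard_sdiff hsub h, hcard]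
  omega

lemma finite_of_terminates (hT : IsBinary T N) {d : ℕ}
    (h : Terminates (fun u => N u ≠ 2) d v) : {w | v ++ w ∈ T}.Finite := by
  have hbarren : ∀ {u}, N u ≠ 2 → {w | u ++ w ∈ T}.Finite := fun {u} hu => by
    refine (Set.finite_singleton []).subset fun w hw => ?_
    rcases w with _ | ⟨j, w⟩
    · rfl
    · exact absurd (hT.mem_nodes.1 (hT.mem_nodes_of_append_cons hw).1).2 hu
  induction d generalizing v with
  | zero => exact hbarren h
  | succ d ih =>
    rcases h with h | ⟨h0, h1⟩
    · exact hbarren h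
    · refine ((((ih h0).image (List.cons 0)).union ((ih h1).image (List.cons 1))).insert []).subset
        fun w hw => ?_
      rcases w with _ | ⟨j, w⟩
      · exact Set.mem_insert _ _
      · have hj := (hT.mem_nodes_of_append_cons hw).2
        rw [Set.mem_ofPred_eq, List.append_cons] at hw
        interval_cases j
        · exact Or.inr (Or.inl ⟨w, hw, rfl⟩)
        · exact Or.inr (Or.inr ⟨w, hw, rfl⟩)

open Classical in
lemma truncate (hT : IsBinary T N) (x : Vertex) :
    IsBinary (truncate T x) (fun v => if x <+: v then 0 else N v) where
  root := ⟨hT.root, List.prefix_nil.1⟩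
  child v j := by
    simp only [ForestFire.truncate, Set.mem_ofPred_eq, hT.child, List.prefix_concat_iff]
    by_cases hx : x <+: v
    · have hne : x ≠ v ++ [j] := by
        rintro rfl
        simpa using hx.length_le
      simp [hx, hne]
    · simp [hx]
  two v := by
    split_ifs
    exacts [Or.inl rfl, hT.two v]

end IsBinary

section Truncate

variable {T : Set Vertex} {v x : Vertex}

lemma mem_nodes_truncate : v ∈ nodes (truncate T x) ↔ v ∈ nodes T ∧ ¬ x <+: v := by
  constructor
  · rintro ⟨h1, j, h2⟩
    refine ⟨⟨h1.1, j, h2.1⟩, fun h => ?_⟩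
    have hx := h2.2 (h.trans (List.prefix_append _ _))
    simpa [hx] using h.length_le
  · rintro ⟨⟨h1, j, h2⟩, hx⟩
    exact ⟨⟨h1, fun h => absurd h hx⟩, j, h2,
      fun h => (List.prefix_concat_iff.1 h).resolve_right hx⟩

end Truncate

/-! ### Heights and cut edges -/

/-- The edge `y` carries a mark of `U`. -/
def IsCut (κ : Vertex → ℝ) (U : Set Mark) (y : Vertex) : Prop := ∃ m ∈ U, InEdge κ m y

/-- The vertex `y ++ z` sends a mark to the edge `y`. -/
def Hits (κ : Vertex → ℝ) (π : Vertex → Set ℝ) (y z : Vertex) : Prop :=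
  (π (y ++ z) ∩ Set.Ioo (bottom κ y) (height κ y)).Nonempty

/-- The nodes above `v`, in coordinates relative to `v`, which no cut separates from `v`. -/
def connectedAbove (T : Set Vertex) (κ : Vertex → ℝ) (U : Set Mark) (v : Vertex) : Set Vertex :=
  {z | v ++ z ∈ nodes T ∧ ∀ u, u ≠ [] → u <+: z → ¬ IsCut κ U (v ++ u)}

/-- The nodes above `v`, in coordinates relative to `v`, which no cut separates from the lower
endpoint of the edge `v`. -/
def aliveAbove (T : Set Vertex) (κ : Vertex → ℝ) (U : Set Mark) (v : Vertex) : Set Vertex :=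
  {z | z ∈ connectedAbove T κ U v ∧ ¬ IsCut κ U v}

section Pruning

variable {T : Set Vertex} {N : Vertex → ℕ} {κ : Vertex → ℝ} {π : Vertex → Set ℝ} {U : Set Mark}
  {m m' : Mark} {v w x y y' z : Vertex} {j : ℕ}

lemma height_eq_bottom_add (κ : Vertex → ℝ) (y : Vertex) : height κ y = bottom κ y + κ y := by
  simp [height, bottom, Finset.sum_range_succ]

lemma bottom_concat (κ : Vertex → ℝ) (v : Vertex) (j : ℕ) :
    bottom κ (v ++ [j]) = height κ v := by
  unfold bottom height
  simp only [List.length_append, List.length_singleton]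
  refine Finset.sum_congr rfl fun i hi => ?_
  rw [List.take_append_of_le_length (by have := Finset.mem_range.1 hi; omega)]

lemma bottom_nonneg (hκ : ∀ v, 0 < κ v) (v : Vertex) : 0 ≤ bottom κ v :=
  Finset.sum_nonneg fun _ _ => (hκ _).le

lemma bottom_lt_height (hκ : ∀ v, 0 < κ v) (v : Vertex) : bottom κ v < height κ v := by
  rw [height_eq_bottom_add]
  exact lt_add_of_pos_right _ (hκ v)

lemma height_le_height_append (hκ : ∀ v, 0 < κ v) (v w : Vertex) :
    height κ v ≤ height κ (v ++ w) := by
  induction w using List.reverseRecOn with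
  | nil => simp
  | append_singleton w j ih =>
    rw [← List.append_assoc]
    exact ih.trans (bottom_concat κ (v ++ w) j ▸ (bottom_lt_height hκ _).le)

lemma height_le_bottom_of_prefix (hκ : ∀ v, 0 < κ v) (h : y <+: x) (hne : y ≠ x) :
    height κ y ≤ bottom κ x := by
  obtain ⟨w, rfl⟩ := h
  induction w using List.reverseRecOn with
  | nil => simp at hne
  | append_singleton w j _ =>
    rw [← List.append_assoc, bottom_concat]
    exact height_le_height_append hκ _ _

lemma InEdge.lt_of_prefix (hκ : ∀ v, 0 < κ v) (hm : InEdge κ m y) (hm' : InEdge κ m' y')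
    (hy : y <+: y') (hne : y ≠ y') : m.2 < m'.2 :=
  (hm.2.2.trans_le (height_le_bottom_of_prefix hκ hy hne)).trans hm'.2.1

lemma InEdge.prefix_of_le (hκ : ∀ v, 0 < κ v) (hm : InEdge κ m y) (hm' : InEdge κ m' y')
    (hy : y <+: x) (hy' : y' <+: x) (h : m.2 ≤ m'.2) : y <+: y' := by
  by_contra hyy'
  have hy'y := (List.prefix_or_prefix_of_prefix hy hy').resolve_left hyy'
  exact h.not_gt (hm'.lt_of_prefix hκ hm hy'y fun hne => hyy' (hne ▸ List.prefix_rfl))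

/-! ### The useful marks -/

lemma useful_eq (h : PruningWellDefined T κ π) (hU : IsUsefulSet T κ π U) :
    useful T κ π = U := by
  have : {U | IsUsefulSet T κ π U} = {U} := Set.eq_singleton_iff_unique_mem.2
    ⟨hU, fun W hW => h.unique hW hU⟩
  rw [useful, this, Set.sUnion_singleton]

lemma isUsefulSet_useful (h : PruningWellDefined T κ π) :
    IsUsefulSet T κ π (useful T κ π) := by
  obtain ⟨V, hV, -⟩ := id h
  rwa [useful_eq h hV]

lemma isCut_iff_exists_hits (hκ : ∀ v, 0 < κ v) (hU : IsUsefulSet T κ π U) :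
    IsCut κ U y ↔ ∃ z ∈ connectedAbove T κ U y, Hits κ π y z := by
  constructor
  · rintro ⟨⟨_, h⟩, hm, hy⟩
    obtain ⟨⟨hx, hh, -⟩, hD⟩ := (hU _).1 hm
    obtain ⟨z, rfl⟩ := hy.1
    refine ⟨z, ⟨hx, ?_⟩, h, hh, hy.2⟩
    rintro u hu huz ⟨m', hm', hy'⟩
    exact hD m' hm' ⟨hy.lt_of_prefix hκ hy' (List.prefix_append _ _) (by simpa using hu),
      y ++ u, hy', (List.prefix_append_right_inj y).2 huz⟩
  · rintro ⟨z, ⟨hz, hu⟩, h, hh, hI⟩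
    have hy : InEdge κ (y ++ z, h) y := ⟨List.prefix_append _ _, hI⟩
    by_contra hc
    have hm : (y ++ z, h) ∉ U := fun hm => hc ⟨_, hm, hy⟩
    rw [hU] at hm
    push Not at hm
    obtain ⟨m', hm', hlt, y', hy', hyx⟩ := hm ⟨hz, hh, y, hy⟩
    obtain ⟨u, rfl⟩ := hy.prefix_of_le hκ hy' (List.prefix_append _ _) hyx hlt.le
    rcases eq_or_ne u [] with rfl | h0
    · exact hc ⟨m', hm', by simpa using hy'⟩
    · exact hu u h0 ((List.prefix_append_right_inj y).1 hyx) ⟨m', hm', hy'⟩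

lemma nil_mem_connectedAbove (hv : v ∈ nodes T) : [] ∈ connectedAbove T κ U v :=
  ⟨by simpa using hv, fun _ hu h => absurd (List.prefix_nil.1 h) hu⟩

lemma cons_mem_connectedAbove :
    j :: z ∈ connectedAbove T κ U v ↔ z ∈ aliveAbove T κ U (v ++ [j]) := by
  simp only [connectedAbove, aliveAbove, Set.mem_ofPred_eq, and_assoc, List.append_cons v j z]
  refine and_congr_right fun _ => ⟨fun h => ⟨fun u _ hz => ?_, h [j] (by simp) (by simp)⟩, ?_⟩
  · rw [← List.append_cons]
    exact h _ (by simp) (by simpa using hz)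
  · rintro ⟨h, hj⟩ (_ | ⟨i, u⟩) hne hu
    · exact absurd rfl hne
    · obtain ⟨rfl, hu'⟩ := List.cons_prefix_cons.1 hu
      rcases eq_or_ne u [] with rfl | hu0
      · exact hj
      · rw [List.append_cons]
        exact h u hu0 hu'

lemma IsBinary.connectedAbove_eq_insert (hT : IsBinary T N) (hv : v ∈ nodes T) :
    connectedAbove T κ U v = insert [] (List.cons 0 '' aliveAbove T κ U (v ++ [0]) ∪
      List.cons 1 '' aliveAbove T κ U (v ++ [1])) := by
  ext z
  rcases z with _ | ⟨j, z⟩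
  · simp [nil_mem_connectedAbove hv]
  · constructor
    · intro hz
      have hj := (hT.mem_nodes_of_append_cons hz.1.1).2
      rw [cons_mem_connectedAbove] at hz
      interval_cases j
      · exact Or.inr (Or.inl ⟨z, hz, rfl⟩)
      · exact Or.inr (Or.inr ⟨z, hz, rfl⟩)
    · rintro (h | ⟨w, hw, h⟩ | ⟨w, hw, h⟩)
      · simp at h
      all_goals
        obtain ⟨rfl, rfl⟩ := List.cons.inj h
        exact cons_mem_connectedAbove.2 hw

lemma aliveAbove_eq_setOf_forall_not_hits (hκ : ∀ v, 0 < κ v) (hU : IsUsefulSet T κ π U) :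
    aliveAbove T κ U v =
      {z | z ∈ connectedAbove T κ U v ∧ ∀ z' ∈ connectedAbove T κ U v, ¬ Hits κ π v z'} := by
  simp only [aliveAbove, isCut_iff_exists_hits hκ hU, not_exists, not_and]

/-! ### Alive nodes, generation by generation -/

/-- The nodes of the binary tree with root `[]` and subtrees `a` and `b` above the root. -/
def graft (a b : Finset Vertex) : Finset Vertex :=
  insert [] (a.image (List.cons 0) ∪ b.image (List.cons 1))

open Classical in
/-- Everything is removed if some vertex of `B` sends a mark, which `h` tells. -/
noncomputable def cutIf (h : Vertex → Prop) (B : Finset Vertex) : Finset Vertex :=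
  if ∃ z ∈ B, h z then ∅ else B

/-- The alive nodes above a vertex with `k` children before a possible cut in the edge below it,
given those above its children. -/
def grow (k : ℕ) (a b : Finset Vertex) : Finset Vertex := if k = 2 then graft a b else ∅

/-- The alive nodes above `v` in the pruning of the tree truncated `d` generations above `v`, where
`e y z` tells whether `y ++ z` sends a mark to the edge `y`. -/
noncomputable def alive (N : Vertex → ℕ) (e : Vertex → Vertex → Prop) :
    ℕ → Vertex → Finset Vertex
  | 0, _ => ∅
  | d + 1, v => cutIf (e v) (grow (N v) (alive N e d (v ++ [0])) (alive N e d (v ++ [1])))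

/-- Nothing above the edge `v` can be alive, either because `v` is not a node or because `v` sends a
mark to this edge. -/
def IsBarren (N : Vertex → ℕ) (e : Vertex → Vertex → Prop) (v : Vertex) : Prop :=
  N v ≠ 2 ∨ e v []

lemma cutIf_empty (h : Vertex → Prop) : cutIf h ∅ = ∅ := by simp [cutIf]

lemma coe_cutIf (h : Vertex → Prop) (B : Finset Vertex) :
    (cutIf h B : Set Vertex) = {z | z ∈ (B : Set Vertex) ∧ ∀ z' ∈ (B : Set Vertex), ¬ h z'} := by
  unfold cutIf
  split_ifs with hB
  · obtain ⟨z, hz, hh⟩ := hB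
    rw [Finset.coe_empty, eq_comm, Set.eq_empty_iff_forall_notMem]
    exact fun _ hw => hw.2 z hz hh
  · push Not at hB
    ext z
    exact ⟨fun hz => ⟨hz, hB⟩, And.left⟩

lemma coe_graft (a b : Finset Vertex) :
    (graft a b : Set Vertex) = insert [] (List.cons 0 '' a ∪ List.cons 1 '' b) := by
  simp [graft]

lemma card_graft (a b : Finset Vertex) : (graft a b).card = a.card + b.card + 1 := by
  unfold graft
  rw [Finset.card_insert_of_notMem (by simp), Finset.card_union_of_disjoint,
    Finset.card_image_of_injective _ List.cons_injective,
    Finset.card_image_of_injective _ List.cons_injective]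
  rw [Finset.disjoint_left]
  simp

section Alive

variable {e : Vertex → Vertex → Prop} {d d' : ℕ}

lemma alive_eq_empty (h : IsBarren N e v) : alive N e d v = ∅ := by
  cases d with
  | zero => rfl
  | succ d =>
    rw [alive, grow]
    split_ifs with h2
    · exact if_pos ⟨[], Finset.mem_insert_self _ _, h.resolve_left (not_not.2 h2)⟩
    · exact cutIf_empty _

lemma alive_succ_of_terminates (h : Terminates (IsBarren N e) d v) :
    alive N e (d + 1) v = alive N e d v := by
  induction d generalizing v with
  | zero => rw [alive_eq_empty h, alive_eq_empty h]
  | succ d ih =>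
    rcases h with h | ⟨h0, h1⟩
    · rw [alive_eq_empty h, alive_eq_empty h]
    · rw [alive, ih h0, ih h1, alive]

lemma alive_eq_of_terminates (h : Terminates (IsBarren N e) d v) (hd : d ≤ d') :
    alive N e d' v = alive N e d v := by
  induction hd with
  | refl => rfl
  | step hd ih => rw [alive_succ_of_terminates (h.of_le hd), ih]

end Alive

lemma IsBinary.aliveAbove_eq_empty (hT : IsBinary T N) (hκ : ∀ v, 0 < κ v)
    (hU : IsUsefulSet T κ π U) (h : IsBarren N (Hits κ π) v) : aliveAbove T κ U v = ∅ := by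
  refine Set.eq_empty_of_forall_notMem fun z ⟨hz, hcut⟩ => ?_
  have hv := hT.mem_nodes_of_append_mem_nodes hz.1
  rcases h with h | h
  · exact h (hT.mem_nodes.1 hv).2
  · exact hcut ((isCut_iff_exists_hits hκ hU).2 ⟨[], nil_mem_connectedAbove hv, h⟩)

theorem IsBinary.coe_alive_eq_aliveAbove (hT : IsBinary T N) (hκ : ∀ v, 0 < κ v)
    (hU : IsUsefulSet T κ π U) {d : ℕ} (h : Terminates (IsBarren N (Hits κ π)) d v) (hv : v ∈ T) :
    (alive N (Hits κ π) d v : Set Vertex) = aliveAbove T κ U v := by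
  induction d generalizing v with
  | zero => rw [alive_eq_empty h, hT.aliveAbove_eq_empty hκ hU h, Finset.coe_empty]
  | succ d ih =>
    by_cases hQ : IsBarren N (Hits κ π) v
    · rw [alive_eq_empty hQ, hT.aliveAbove_eq_empty hκ hU hQ, Finset.coe_empty]
    · have h2 : N v = 2 := not_not.1 fun h2 => hQ (Or.inl h2)
      have hnode := hT.mem_nodes.2 ⟨hv, h2⟩
      obtain ⟨h0, h1⟩ := h.resolve_left hQ
      rw [alive, grow, if_pos h2, coe_cutIf, coe_graft,
        ih h0 (hT.concat_mem.2 ⟨hnode, by omega⟩), ih h1 (hT.concat_mem.2 ⟨hnode, by omega⟩),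
        ← hT.connectedAbove_eq_insert hnode, aliveAbove_eq_setOf_forall_not_hits hκ hU]

/-! ### The pruned tree -/

lemma mem_prune : v ∈ prune T κ π ↔ v ∈ T ∧ ∀ y, IsCut κ (useful T κ π) y → y <+: v → y = v :=
  and_congr_right fun _ =>
    ⟨fun H y ⟨m, hm, hy⟩ => H m hm y hy, fun H m hm y hy => H y ⟨m, hm, hy⟩⟩

lemma mem_aliveAbove_nil :
    w ∈ aliveAbove T κ U [] ↔ w ∈ nodes T ∧ ∀ u, u <+: w → ¬ IsCut κ U u := by
  simp only [aliveAbove, connectedAbove, Set.mem_ofPred_eq, List.nil_append, and_assoc]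
  refine and_congr_right fun _ => ⟨fun ⟨h, h0⟩ u hu => ?_,
    fun h => ⟨fun u _ => h u, h [] List.nil_prefix⟩⟩
  rcases eq_or_ne u [] with rfl | hne
  exacts [h0, h u hne hu]

lemma IsBinary.concat_mem_prune (hT : IsBinary T N) :
    w ++ [j] ∈ prune T κ π ↔ w ∈ aliveAbove T κ (useful T κ π) [] ∧ j < 2 := by
  rw [mem_prune, hT.concat_mem, mem_aliveAbove_nil]
  constructor
  · rintro ⟨⟨hw, hj⟩, hcut⟩
    refine ⟨⟨hw, fun u hu hc => ?_⟩, hj⟩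
    have hne : u = w ++ [j] := hcut u hc (hu.trans (List.prefix_append _ _))
    simpa [hne] using hu.length_le
  · rintro ⟨⟨hw, hcut⟩, hj⟩
    exact ⟨⟨hw, hj⟩, fun y hy hyw => (List.prefix_concat_iff.1 hyw).resolve_right
      fun h => hcut y h hy⟩

lemma aliveAbove_nil_subset_prune : aliveAbove T κ (useful T κ π) [] ⊆ prune T κ π := fun _ hw =>
  have ⟨hw, hcut⟩ := mem_aliveAbove_nil.1 hw
  mem_prune.2 ⟨hw.1, fun y hy hyw => absurd hy (hcut y hyw)⟩

lemma IsBinary.nodes_prune (hT : IsBinary T N) :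
    nodes (prune T κ π) = aliveAbove T κ (useful T κ π) [] := by
  ext w
  exact ⟨fun ⟨_, j, hj⟩ => (hT.concat_mem_prune.1 hj).1,
    fun hw => ⟨aliveAbove_nil_subset_prune hw, 0, hT.concat_mem_prune.2 ⟨hw, by omega⟩⟩⟩

open Classical in
lemma IsBinary.prune (hT : IsBinary T N) : IsBinary (prune T κ π)
    (fun v => if v ∈ aliveAbove T κ (useful T κ π) [] then 2 else 0) where
  root := mem_prune.2 ⟨hT.root, fun _ _ => List.prefix_nil.1⟩
  child v j := by
    rw [hT.concat_mem_prune]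
    split_ifs with hv
    · simp [hv, aliveAbove_nil_subset_prune hv]
    · simp [hv]
  two v := by
    split_ifs
    exacts [Or.inr rfl, Or.inl rfl]

end Pruning

/-! ### Own marks -/

/-- The mark `m` is sent from above the edge `x` to a point below this edge. -/
def Crosses (κ : Vertex → ℝ) (x : Vertex) (m : Mark) : Prop := x <+: m.1 ∧ m.2 < bottom κ x

section OwnMark

variable {T : Set Vertex} {κ : Vertex → ℝ} {π : Vertex → Set ℝ} {U : Set Mark}
  {m m' : Mark} {x y : Vertex} {t : ℝ}

lemma InEdge.not_crosses_iff (hκ : ∀ v, 0 < κ v) (hy : InEdge κ m y) (hx : x <+: m.1) :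
    ¬ Crosses κ x m ↔ x <+: y := by
  constructor
  · intro h
    by_contra hxy
    have hyx := (List.prefix_or_prefix_of_prefix hx hy.1).resolve_left hxy
    have hne : y ≠ x := fun h => hxy (h ▸ List.prefix_rfl)
    exact h ⟨hx, hy.2.2.trans_le (height_le_bottom_of_prefix hκ hyx hne)⟩
  · rintro h ⟨-, hlt⟩
    rcases eq_or_ne x y with rfl | hne
    · exact hlt.not_gt hy.2.1
    · exact (hlt.trans (bottom_lt_height hκ x)).not_ge
        ((height_le_bottom_of_prefix hκ h hne).trans hy.2.1.le)

lemma Deactivates.prefix_of_not_crosses (hκ : ∀ v, 0 < κ v) (h : Deactivates κ m' m)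
    (hx : x <+: m'.1) (hc : ¬ Crosses κ x m') : x <+: m.1 := by
  obtain ⟨-, y, hy, hym⟩ := h
  exact ((hy.not_crosses_iff hκ hx).1 hc).trans hym

lemma Crosses.dominates (hm : Crosses κ x m) (hx : InEdge κ (x, t) x) :
    Dominates (Deactivates κ) (x, t) m := by
  have hlt : m.2 < t := hm.2.trans hx.2.1
  exact ⟨⟨hlt, x, hx, hm.1⟩, fun _ ⟨h, y, hy, hyx⟩ => ⟨hlt.trans h, y, hy, hyx.trans hm.1⟩⟩

lemma hits_nil_iff : Hits κ π x [] ↔ ∃ t ∈ π x, InEdge κ (x, t) x := by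
  simp [Hits, Set.Nonempty, InEdge]

lemma mem_marks_of_inEdge (hx : x ∈ nodes T) (ht : t ∈ π x) (hE : InEdge κ (x, t) y) :
    (x, t) ∈ marks T κ π := ⟨hx, ht, y, hE⟩

lemma IsUsefulSet.not_crosses (hU : IsUsefulSet T κ π U) (hx : x ∈ nodes T) (h : Hits κ π x [])
    (hm : m ∈ U) : ¬ Crosses κ x m := fun hc =>
  have ⟨_, ht, hE⟩ := hits_nil_iff.1 h
  IsKernel.notMem_of_dominates hU (mem_marks_of_inEdge hx ht hE) (hc.dominates hE) hm

/-- The marks which no own mark prevents from being useful. -/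
def uncrossingMarks (T : Set Vertex) (κ : Vertex → ℝ) (π : Vertex → Set ℝ) : Set Mark :=
  {m | m ∈ marks T κ π ∧ ∀ x ∈ nodes T, Hits κ π x [] → ¬ Crosses κ x m}

lemma isUsefulSet_iff_isKernel_uncrossingMarks (hκ : ∀ v, 0 < κ v) :
    IsUsefulSet T κ π U ↔ IsKernel (Deactivates κ) (uncrossingMarks T κ π) U := by
  refine isKernel_iff_of_dominates (fun m hm => hm.1) fun m hm hm' => ?_
  obtain ⟨x, hx, h, hc⟩ : ∃ x ∈ nodes T, Hits κ π x [] ∧ Crosses κ x m := by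
    by_contra! hall
    exact hm' ⟨hm, hall⟩
  obtain ⟨t, ht, hE⟩ := hits_nil_iff.1 h
  exact ⟨(x, t), ⟨mem_marks_of_inEdge hx ht hE, fun y _ _ hy =>
    (hE.not_crosses_iff hκ hy.1).2 hy.1 hy⟩, hc.dominates hE⟩

theorem pruningWellDefined_of_forall_exists_own_mark (hκ : ∀ v, 0 < κ v)
    (h : ∀ m ∈ marks T κ π, ∃ x ∈ nodes T, Hits κ π x [] ∧ ¬ x <+: m.1 ∧
      {m' ∈ marks T κ π | ¬ x <+: m'.1}.Finite) : PruningWellDefined T κ π := by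
  unfold PruningWellDefined
  simp only [isUsefulSet_iff_isKernel_uncrossingMarks hκ]
  refine existsUnique_isKernel
    (wellFoundedOn_of_forall_exists_finite Prod.snd (fun _ _ hD => hD.1) fun m hm => ?_)
  obtain ⟨x, hx, hown, hxm, hfin⟩ := h m hm.1
  exact ⟨_, hfin, ⟨hm.1, hxm⟩, fun a ha b _ hD hb =>
    ⟨ha.1, fun hxa => hb.2 (hD.prefix_of_not_crosses hκ hxa (ha.2 x hx hown))⟩⟩

lemma pruningWellDefined_of_finite (h : (marks T κ π).Finite) : PruningWellDefined T κ π :=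
  existsUnique_isKernel (wellFoundedOn_of_forall_exists_finite Prod.snd (fun _ _ hD => hD.1)
    fun _ hm => ⟨_, h, hm, fun _ ha _ _ _ _ => ha⟩)

lemma finite_marks (hκ : ∀ v, 0 < κ v) (hT : T.Finite)
    (hπ : ∀ v (r : ℕ), (π v ∩ Set.Ioo 0 (r : ℝ)).Finite) : (marks T κ π).Finite := by
  refine (hT.biUnion fun x _ => (Set.finite_singleton x).prod (hπ x ⌈height κ x⌉₊)).subset ?_
  rintro ⟨x, t⟩ ⟨hx, ht, y, hy⟩
  obtain ⟨z, rfl⟩ := hy.1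
  exact Set.mem_biUnion hx.1 ⟨rfl, ht, (bottom_nonneg hκ y).trans_lt hy.2.1,
    hy.2.2.trans_le ((height_le_height_append hκ y z).trans (Nat.le_ceil _))⟩

lemma marks_truncate : marks (truncate T x) κ π = {m ∈ marks T κ π | ¬ x <+: m.1} := by
  ext m
  simp only [marks, Set.mem_ofPred_eq, mem_nodes_truncate]
  tauto

lemma IsUsefulSet.truncate (hκ : ∀ v, 0 < κ v) (hU : IsUsefulSet T κ π U) (hx : x ∈ nodes T)
    (h : Hits κ π x []) :
    IsUsefulSet (truncate T x) κ π (U ∩ marks (ForestFire.truncate T x) κ π) := by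
  refine IsKernel.inter hU (fun m hm => (marks_truncate ▸ hm).1) fun a ha b hb hD => ?_
  rw [marks_truncate] at hb ⊢
  exact ⟨IsKernel.subset hU ha,
    fun hxa => hb.2 (hD.prefix_of_not_crosses hκ hxa (hU.not_crosses hx h ha))⟩

theorem prune_truncate (hκ : ∀ v, 0 < κ v) (hW : PruningWellDefined T κ π) (hx : x ∈ nodes T)
    (h : Hits κ π x []) (hWx : PruningWellDefined (truncate T x) κ π) :
    prune (truncate T x) κ π = prune T κ π := by
  have hU := isUsefulSet_useful hW
  ext v
  rw [mem_prune, mem_prune, useful_eq hWx (hU.truncate hκ hx h)]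
  constructor
  · rintro ⟨hv, hcut⟩
    refine ⟨hv.1, ?_⟩
    rintro y ⟨m, hm, hy⟩ hyv
    by_cases hxy : x <+: y
    · obtain rfl := hv.2 (hxy.trans hyv)
      exact hyv.eq_of_length_le hxy.length_le
    · refine hcut y ⟨m, ⟨hm, ?_⟩, hy⟩ hyv
      rw [marks_truncate]
      exact ⟨IsKernel.subset hU hm,
        fun hxm => hxy ((hy.not_crosses_iff hκ hxm).1 (hU.not_crosses hx h hm))⟩
  · rintro ⟨hv, hcut⟩
    have hxcut : IsCut κ (useful T κ π) x :=
      (isCut_iff_exists_hits hκ hU).2 ⟨[], nil_mem_connectedAbove hx, h⟩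
    exact ⟨⟨hv, hcut x hxcut⟩, fun y ⟨m, hm, hy⟩ => hcut y ⟨m, hm.1, hy⟩⟩

end OwnMark

/-! ### The size-biased tree -/

/-- The offspring numbers of the tree obtained by planting on the backbone the Galton-Watson trees
with offspring numbers `ν i`. -/
def offspring : (ℕ → Vertex → ℕ) → Vertex → ℕ
  | _, [] => 2
  | ν, 0 :: w => ν 0 w
  | ν, 1 :: w => offspring (fun i => ν (i + 1)) w
  | _, (_ + 2) :: _ => 0

lemma concat_mem_galtonWatson {ν : Vertex → ℕ} {v : Vertex} {j : ℕ} :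
    v ++ [j] ∈ galtonWatson ν ↔ v ∈ galtonWatson ν ∧ j < ν v := by
  constructor
  · intro h
    exact ⟨fun u i hu => h u i (hu.trans (List.prefix_append _ _)), h v j List.prefix_rfl⟩
  · rintro ⟨h, hj⟩ u i hu
    rcases List.prefix_concat_iff.1 hu with hu | hu
    · obtain ⟨rfl, hij⟩ := List.append_inj' hu rfl
      rwa [List.singleton_inj.1 hij]
    · exact h u i hu

lemma nil_mem_galtonWatson (ν : Vertex → ℕ) : [] ∈ galtonWatson ν := fun u i h => by simp at h

lemma spine_concat (i : ℕ) : spine i ++ [1] = spine (i + 1) := by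
  simp [spine, List.replicate_succ']

lemma length_spine (i : ℕ) : (spine i).length = i := List.length_replicate

lemma exists_terminates_nil {Q : Vertex → Prop} {j : ℕ} (hj : Q (spine j))
    (h : ∀ i, ∃ d, Terminates Q d (spine i ++ [0])) : ∃ d, Terminates Q d [] := by
  refine Nat.decreasingInduction (motive := fun i _ => ∃ d, Terminates Q d (spine i))
    (fun i _ ⟨d, hd⟩ => ?_) ⟨0, hj⟩ j.zero_le
  obtain ⟨d', hd'⟩ := h i
  exact ⟨max d' d + 1, Or.inr ⟨hd'.of_le (le_max_left _ _),
    spine_concat i ▸ hd.of_le (le_max_right _ _)⟩⟩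

lemma nil_mem_backboneTree (G : ℕ → Set Vertex) : [] ∈ backboneTree G := Or.inl ⟨0, rfl⟩

lemma cons_mem_backboneTree {G : ℕ → Set Vertex} {j : ℕ} {w : Vertex} :
    j :: w ∈ backboneTree G ↔
      (j = 0 ∧ w ∈ G 0) ∨ (j = 1 ∧ w ∈ backboneTree fun i => G (i + 1)) := by
  constructor
  · rintro (⟨_ | i, hi⟩ | ⟨_ | i, u, hu, hi⟩)
    · simp [spine] at hi
    · obtain ⟨rfl, rfl⟩ := List.cons.inj hi
      exact Or.inr ⟨rfl, Or.inl ⟨i, rfl⟩⟩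
    · obtain ⟨rfl, rfl⟩ := List.cons.inj hi
      exact Or.inl ⟨rfl, hu⟩
    · obtain ⟨rfl, rfl⟩ := List.cons.inj hi
      exact Or.inr ⟨rfl, Or.inr ⟨i, u, hu, rfl⟩⟩
  · rintro (⟨rfl, hw⟩ | ⟨rfl, ⟨i, rfl⟩ | ⟨i, u, hu, rfl⟩⟩)
    · exact Or.inr ⟨0, w, hw, rfl⟩
    · exact Or.inl ⟨i + 1, rfl⟩
    · exact Or.inr ⟨i + 1, u, hu, rfl⟩

lemma concat_mem_backboneTree {ν : ℕ → Vertex → ℕ} {v : Vertex} {j : ℕ} :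
    v ++ [j] ∈ backboneTree (fun i => galtonWatson (ν i)) ↔
      v ∈ backboneTree (fun i => galtonWatson (ν i)) ∧ j < offspring ν v := by
  induction v generalizing ν with
  | nil =>
    rw [List.nil_append, cons_mem_backboneTree]
    simp only [nil_mem_galtonWatson, nil_mem_backboneTree, offspring, and_true, true_and]
    omega
  | cons i w ih =>
    have ih' := ih (ν := fun i => ν (i + 1))
    rw [List.cons_append, cons_mem_backboneTree, cons_mem_backboneTree, concat_mem_galtonWatson,
      ih']
    rcases i with _ | _ | i <;> simp [offspring]

lemma offspring_spine (ν : ℕ → Vertex → ℕ) (i : ℕ) : offspring ν (spine i) = 2 := by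
  induction i generalizing ν with
  | zero => rfl
  | succ _ ih => exact ih _

lemma offspring_planted (ν : ℕ → Vertex → ℕ) (i : ℕ) (w : Vertex) :
    offspring ν (spine i ++ 0 :: w) = ν i w := by
  induction i generalizing ν with
  | zero => rfl
  | succ _ ih => exact ih _

lemma offspring_eq_zero_or_two {ν : ℕ → Vertex → ℕ} (h : ∀ i v, ν i v = 0 ∨ ν i v = 2)
    (v : Vertex) : offspring ν v = 0 ∨ offspring ν v = 2 := by
  induction v generalizing ν with
  | nil => exact Or.inr rfl
  | cons j w ih =>
    rcases j with _ | _ | j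
    · exact h 0 w
    · exact ih fun i v => h (i + 1) v
    · exact Or.inl rfl

lemma isBinary_backboneTree {ν : ℕ → Vertex → ℕ} (h : ∀ i v, ν i v = 0 ∨ ν i v = 2) :
    IsBinary (backboneTree fun i => galtonWatson (ν i)) (offspring ν) :=
  ⟨nil_mem_backboneTree _, fun _ _ => concat_mem_backboneTree, offspring_eq_zero_or_two h⟩

/-! ### Regular inputs -/

/-- The properties of the input, valid almost surely, from which the pruning is well defined. -/
structure IsRegular (ν : ℕ → Vertex → ℕ) (κ : Vertex → ℝ) (π : Vertex → Set ℝ) : Prop where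
  offspring_eq : ∀ i v, ν i v = 0 ∨ ν i v = 2
  length_pos : ∀ v, 0 < κ v
  finite : ∀ v (r : ℕ), (π v ∩ Set.Ioo 0 (r : ℝ)).Finite
  extinct : ∀ i, ∃ d, Terminates (fun v => offspring ν v ≠ 2) d (spine i ++ [0])
  own_mark : ∀ i, ∃ j ≥ i, Hits κ π (spine j) []

namespace IsRegular

variable {ν : ℕ → Vertex → ℕ} {κ : Vertex → ℝ} {π : Vertex → Set ℝ}

lemma isBinary (h : IsRegular ν κ π) :
    IsBinary (backboneTree fun i => galtonWatson (ν i)) (offspring ν) :=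
  isBinary_backboneTree h.offspring_eq

lemma spine_mem_nodes (h : IsRegular ν κ π) (j : ℕ) :
    spine j ∈ nodes (backboneTree fun i => galtonWatson (ν i)) :=
  h.isBinary.mem_nodes.2 ⟨Or.inl ⟨j, rfl⟩, offspring_spine ν j⟩

lemma finite_truncate (h : IsRegular ν κ π) (j : ℕ) :
    (truncate (backboneTree fun i => galtonWatson (ν i)) (spine j)).Finite := by
  classical
  obtain ⟨d, hd⟩ := exists_terminates_nil (j := j)
    (Q := fun v => (if spine j <+: v then 0 else offspring ν v) ≠ 2) (by simp)
    fun i => (h.extinct i).imp fun d hd => hd.mono fun v hv => by split_ifs <;> simp [hv]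
  simpa using (h.isBinary.truncate (spine j)).finite_of_terminates hd

lemma finite_marks_truncate (h : IsRegular ν κ π) (j : ℕ) :
    (marks (truncate (backboneTree fun i => galtonWatson (ν i)) (spine j)) κ π).Finite :=
  finite_marks h.length_pos (h.finite_truncate j) h.finite

lemma pruningWellDefined_truncate (h : IsRegular ν κ π) (j : ℕ) :
    PruningWellDefined (truncate (backboneTree fun i => galtonWatson (ν i)) (spine j)) κ π :=
  pruningWellDefined_of_finite (h.finite_marks_truncate j)

theorem pruningWellDefined (h : IsRegular ν κ π) :
    PruningWellDefined (backboneTree fun i => galtonWatson (ν i)) κ π := by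
  refine pruningWellDefined_of_forall_exists_own_mark h.length_pos fun m _ => ?_
  obtain ⟨j, hj, hown⟩ := h.own_mark (m.1.length + 1)
  refine ⟨spine j, h.spine_mem_nodes j, hown, fun hp => ?_, ?_⟩
  · have := hp.length_le
    rw [length_spine] at this
    omega
  · rw [← marks_truncate]
    exact h.finite_marks_truncate j

lemma prune_truncate (h : IsRegular ν κ π) {j : ℕ} (hj : Hits κ π (spine j) []) :
    prune (truncate (backboneTree fun i => galtonWatson (ν i)) (spine j)) κ π =
      prune (backboneTree fun i => galtonWatson (ν i)) κ π :=
  ForestFire.prune_truncate h.length_pos h.pruningWellDefined (h.spine_mem_nodes j) hj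
    (h.pruningWellDefined_truncate j)

lemma exists_terminates (h : IsRegular ν κ π) :
    ∃ d, Terminates (IsBarren (offspring ν) (Hits κ π)) d [] := by
  obtain ⟨j, -, hj⟩ := h.own_mark 0
  exact exists_terminates_nil (Or.inr hj)
    fun i => (h.extinct i).imp fun d hd => hd.mono fun v => Or.inl

theorem finite_prune_and_ncard_leaves (h : IsRegular ν κ π) {d : ℕ}
    (hd : Terminates (IsBarren (offspring ν) (Hits κ π)) d []) :
    (prune (backboneTree fun i => galtonWatson (ν i)) κ π).Finite ∧
      (leaves (prune (backboneTree fun i => galtonWatson (ν i)) κ π)).ncard =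
        (alive (offspring ν) (Hits κ π) d []).card + 1 := by
  have hnodes : nodes (prune (backboneTree fun i => galtonWatson (ν i)) κ π) =
      (alive (offspring ν) (Hits κ π) d [] : Set Vertex) := by
    rw [h.isBinary.nodes_prune, h.isBinary.coe_alive_eq_aliveAbove h.length_pos
      (isUsefulSet_useful h.pruningWellDefined) hd h.isBinary.root]
  have hfin := hnodes ▸ Finset.finite_toSet _
  exact ⟨h.isBinary.prune.finite_of_finite_nodes hfin, by
    rw [h.isBinary.prune.ncard_leaves hfin, hnodes, Set.ncard_coe_finset]⟩

end IsRegular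

/-! ### Independence of the marks sent to different edges -/

open scoped ENNReal in
lemma lintegral_exp_neg_mul_expMeasure {s : ℝ} (hs : 0 ≤ s) :
    ∫⁻ x, ENNReal.ofReal (Real.exp (-(s * x))) ∂(expMeasure 2) = ENNReal.ofReal (2 / (2 + s)) := by
  have h : expMeasure 2 = volume.withDensity (exponentialPDF 2) := rfl
  have hm : ∀ r, Measurable (exponentialPDF r) := fun r =>
    (measurable_exponentialPDFReal r).ennreal_ofReal
  rw [h, lintegral_withDensity_eq_lintegral_mul _ (hm 2) (by fun_prop)]
  have : ∀ x, (exponentialPDF 2 * fun x => ENNReal.ofReal (Real.exp (-(s * x)))) x =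
      ENNReal.ofReal (2 / (2 + s)) * exponentialPDF (2 + s) x := by
    intro x
    rw [Pi.mul_apply, exponentialPDF_eq, exponentialPDF_eq]
    split_ifs with hx
    · rw [← ENNReal.ofReal_mul (by positivity), ← ENNReal.ofReal_mul (by positivity)]
      congr 1
      rw [show -((2 + s) * x) = -(2 * x) + -(s * x) by ring, Real.exp_add]
      field_simp
    · simp
  simp_rw [this]
  rw [lintegral_const_mul _ (hm _), lintegral_exponentialPDF_eq_one (by positivity), mul_one]

lemma expMeasure_Iic_zero : expMeasure 2 (Set.Iic 0) = 0 := by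
  have : IsProbabilityMeasure (expMeasure 2) := isProbabilityMeasure_expMeasure two_pos
  rw [← ofReal_cdf, cdf_expMeasure_eq two_pos]
  simp

/-- The part in `(0, ∞)` of the edge `y`. The edge lengths are only almost surely positive, whereas
the counts of a Poisson point process are only known to be measurable in `(0, ∞)`. -/
def posEdge (κ : Vertex → ℝ) (y : Vertex) : Set ℝ := Set.Ioo (max 0 (bottom κ y)) (height κ y)

lemma posEdge_subset_Ioi (κ : Vertex → ℝ) (y : Vertex) : posEdge κ y ⊆ Set.Ioi 0 :=
  fun _ ht => (le_max_left _ _).trans_lt ht.1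

lemma measurableSet_posEdge (κ : Vertex → ℝ) (y : Vertex) : MeasurableSet (posEdge κ y) :=
  measurableSet_Ioo

lemma posEdge_eq_Ioo {κ : Vertex → ℝ} (hκ : ∀ v, 0 < κ v) (y : Vertex) :
    posEdge κ y = Set.Ioo (bottom κ y) (height κ y) := by
  rw [posEdge, max_eq_right (bottom_nonneg hκ y)]

lemma volume_posEdge {κ : Vertex → ℝ} (hκ : ∀ v, 0 < κ v) (y : Vertex) :
    volume (posEdge κ y) = ENNReal.ofReal (κ y) := by
  rw [posEdge_eq_Ioo hκ, Real.volume_Ioo, height_eq_bottom_add, add_sub_cancel_left]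

lemma pairwiseDisjoint_posEdge {κ : Vertex → ℝ} (hκ : ∀ v, 0 < κ v) (x : Vertex) :
    {y | y <+: x}.PairwiseDisjoint (posEdge κ) := by
  intro y hy y' hy' hne
  rw [Function.onFun, posEdge_eq_Ioo hκ, posEdge_eq_Ioo hκ, Set.disjoint_left]
  intro t ht ht'
  rcases List.prefix_or_prefix_of_prefix hy hy' with h | h
  · linarith [ht.2, ht'.1, height_le_bottom_of_prefix hκ h hne]
  · linarith [ht.1, ht'.2, height_le_bottom_of_prefix hκ h hne.symm]

lemma volume_biUnion_posEdge {κ : Vertex → ℝ} (hκ : ∀ v, 0 < κ v) {x : Vertex} {E : Finset Vertex}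
    (hE : ∀ y ∈ E, y <+: x) :
    volume (⋃ y ∈ E, posEdge κ y) = ENNReal.ofReal (∑ y ∈ E, κ y) := by
  rw [measure_biUnion_finset ((pairwiseDisjoint_posEdge hκ x).subset hE)
    fun y _ => measurableSet_posEdge κ y, ENNReal.ofReal_sum_of_nonneg fun y _ => (hκ y).le]
  exact Finset.sum_congr rfl fun y _ => volume_posEdge hκ y

/-- The vertex `y ++ z` sends a mark to the part in `(0, ∞)` of the edge `y`. -/
def PosHits (κ : Vertex → ℝ) (π : Vertex → Set ℝ) (y z : Vertex) : Prop :=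
  (π (y ++ z) ∩ posEdge κ y).Nonempty

lemma posHits_eq_hits {κ : Vertex → ℝ} (hκ : ∀ v, 0 < κ v) (π : Vertex → Set ℝ) :
    PosHits κ π = Hits κ π := by
  funext y z
  rw [PosHits, Hits, posEdge_eq_Ioo hκ]

/-- The intervals with rational endpoints which contain points of `π v ∩ (0, ∞)`. This encodes the
point processes as a random element of a countable product, to which Fubini's theorem applies. -/
def ratPoints (π : Vertex → Set ℝ) (v : Vertex) (q r : ℚ) : Prop :=
  (π v ∩ Set.Ioo (max 0 (q : ℝ)) r).Nonempty

/-- `PosHits` in terms of `ratPoints`. -/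
def RatHits (κ : Vertex → ℝ) (φ : Vertex → ℚ → ℚ → Prop) (y z : Vertex) : Prop :=
  ∃ q r : ℚ, bottom κ y < q ∧ r < height κ y ∧ φ (y ++ z) q r

lemma ratHits_ratPoints (κ : Vertex → ℝ) (π : Vertex → Set ℝ) (y z : Vertex) :
    RatHits κ (ratPoints π) y z ↔ PosHits κ π y z := by
  constructor
  · rintro ⟨q, r, hq, hr, h, hh, h1, h2⟩
    exact ⟨h, hh, (max_le_max le_rfl hq.le).trans_lt h1, h2.trans hr⟩
  · rintro ⟨h, hh, h1, h2⟩
    obtain ⟨q, hq, hq'⟩ := exists_rat_btwn ((le_max_right _ _).trans_lt h1)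
    obtain ⟨r, hr, hr'⟩ := exists_rat_btwn h2
    exact ⟨q, r, hq, hr', h, hh, max_lt ((le_max_left _ _).trans_lt h1) hq', hr⟩

lemma measurable_ratHits (y z : Vertex) :
    Measurable fun p : (Vertex → ℝ) × (Vertex → ℚ → ℚ → Prop) => RatHits p.1 p.2 y z := by
  have hb : Measurable fun p : (Vertex → ℝ) × (Vertex → ℚ → ℚ → Prop) => bottom p.1 y := by
    unfold bottom
    fun_prop
  have hh : Measurable fun p : (Vertex → ℝ) × (Vertex → ℚ → ℚ → Prop) => height p.1 y := by
    unfold height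
    fun_prop
  unfold RatHits
  refine Measurable.exists fun q => Measurable.exists fun r => ?_
  refine (measurableSet_setOfPred.1 (measurableSet_lt hb measurable_const)).and
    ((measurableSet_setOfPred.1 (measurableSet_lt measurable_const hh)).and ?_)
  fun_prop

lemma measurableSet_inter_eq_empty {Ω : Type*} (N : Ω → Set ℝ) {B : Set ℝ}
    (hB : MeasurableSet B) (h0 : B ⊆ Set.Ioi 0) :
    MeasurableSet[pointSigma N] {ω | N ω ∩ B = ∅} := by
  have h1 : MeasurableSpace.comap (fun ω => (N ω ∩ B).encard) ⊤ ≤ pointSigma N :=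
    le_iSup_of_le B (le_iSup_of_le hB (le_iSup_of_le h0 le_rfl))
  have h2 : MeasurableSet[pointSigma N] {ω | (N ω ∩ B).encard = 0} :=
    h1 _ ⟨{0}, trivial, rfl⟩
  simpa only [Set.encard_eq_zero] using h2

lemma measurable_nonempty_inter {Ω : Type*} (N : Ω → Set ℝ) {B : Set ℝ} (hB : MeasurableSet B)
    (h0 : B ⊆ Set.Ioi 0) : Measurable[pointSigma N] fun ω => (N ω ∩ B).Nonempty := by
  refine (@measurableSet_setOfPred _ (pointSigma N) _).1 ?_
  convert (measurableSet_inter_eq_empty N hB h0).compl using 1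
  ext ω
  simp [Set.nonempty_iff_ne_empty]

lemma measurable_ratPoints {Ω : Type*} [m : MeasurableSpace Ω] (π : Vertex → Ω → Set ℝ)
    (h : ∀ v, pointSigma (π v) ≤ m) : Measurable fun ω => ratPoints fun v => π v ω := by
  refine measurable_pi_iff.2 fun v => measurable_pi_iff.2 fun q => measurable_pi_iff.2 fun r => ?_
  refine Measurable.mono (measurable_nonempty_inter (π v) measurableSet_Ioo fun x hx => ?_)
    (h v) le_rfl
  exact (le_max_left _ _).trans_lt hx.1

section Input

variable {Ω : Type*} [mΩ : MeasurableSpace Ω] {P : Measure Ω} {n : ℕ}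
  {ν : ℕ → Vertex → Ω → ℕ} {κ : Vertex → Ω → ℝ} {π : Vertex → Ω → Set ℝ}

lemma IsPoissonPointProcess.measure_inter_eq_empty {r : ℝ≥0} {N : Ω → Set ℝ}
    (h : IsPoissonPointProcess P r N) {B : Set ℝ} (hB : MeasurableSet B) (h0 : B ⊆ Set.Ioi 0)
    (hv : volume B ≠ ⊤) :
    P {ω | N ω ∩ B = ∅} = ENNReal.ofReal (Real.exp (-(r * (volume B).toReal))) := by
  have := h.count_law B hB h0 hv 0
  simp only [Nat.cast_zero, Set.encard_eq_zero] at this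
  rw [this, poissonMeasure_singleton]
  simp [ENNReal.toReal]

namespace IsInput

lemma inputSigma_le (h : IsInput P n ν κ π) (i) : inputSigma ν κ π i ≤ mΩ := by
  rcases i with p | v | v
  · exact (h.measurable_offspring _ _).comap_le
  · exact (h.measurable_length _).comap_le
  · refine iSup_le fun B => iSup_le fun hB => iSup_le fun h0 => ?_
    rintro s ⟨t, -, rfl⟩
    exact ((h.poisson v).measurable_count B hB h0) (MeasurableSet.of_discrete)

lemma ae_length_pos (h : IsInput P n ν κ π) : ∀ᵐ ω ∂P, ∀ v, 0 < κ v ω := by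
  rw [ae_all_iff]
  intro v
  have h1 : P (κ v ⁻¹' Set.Iic 0) = 0 := by
    rw [← Measure.map_apply (h.measurable_length v) measurableSet_Iic, h.length_law,
      expMeasure_Iic_zero]
  filter_upwards [measure_eq_zero_iff_ae_notMem.1 h1] with ω hω
  simpa using hω

lemma measurable_lengths (h : IsInput P n ν κ π) : Measurable fun ω v => κ v ω :=
  measurable_pi_iff.2 h.measurable_length

lemma measurable_ratPoints (h : IsInput P n ν κ π) :
    Measurable fun ω => ratPoints fun v => π v ω :=
  ForestFire.measurable_ratPoints π fun v => h.inputSigma_le (.inr (.inr v))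

lemma indepFun_lengths_ratPoints (h : IsInput P n ν κ π) :
    IndepFun (fun ω v => κ v ω) (fun ω => ratPoints fun v => π v ω) P := by
  have hd : Disjoint (Set.range fun v : Vertex => (.inr (.inl v) : (ℕ × Vertex) ⊕ Vertex ⊕ Vertex))
      (Set.range fun v : Vertex => .inr (.inr v)) := by
    rw [Set.disjoint_left]
    rintro _ ⟨v, rfl⟩ ⟨w, hw⟩
    simp at hw
  have := indep_iSup_of_disjoint h.inputSigma_le h.indep hd
  rw [iSup_range, iSup_range] at this
  rw [IndepFun_iff_Indep]
  refine indep_of_indep_of_le_right (indep_of_indep_of_le_left this ?_)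
    (ForestFire.measurable_ratPoints (m := ⨆ v, pointSigma (π v)) π
      fun v => le_iSup (fun v => pointSigma (π v)) v).comap_le
  refine Measurable.comap_le ?_
  refine (@measurable_pi_iff Ω Vertex (fun _ => ℝ) (⨆ v, inputSigma ν κ π (.inr (.inl v))) _ _).2
    fun v => ?_
  exact Measurable.mono (comap_measurable (κ v))
    (le_iSup (fun v => inputSigma ν κ π (.inr (.inl v))) v) le_rfl

lemma measure_forall_inter_eq_empty (h : IsInput P n ν κ π) (X : Finset Vertex)
    {B : Vertex → Set ℝ} (hB : ∀ x ∈ X, MeasurableSet (B x)) (h0 : ∀ x ∈ X, B x ⊆ Set.Ioi 0)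
    (hv : ∀ x ∈ X, volume (B x) ≠ ⊤) :
    P {ω | ∀ x ∈ X, π x ω ∩ B x = ∅} =
      ENNReal.ofReal (Real.exp (-(∑ x ∈ X, (volume (B x)).toReal / n))) := by
  have hind : iIndep (fun v => inputSigma ν κ π (.inr (.inr v))) P :=
    h.indep.precomp (g := fun v : Vertex => (.inr (.inr v) : (ℕ × Vertex) ⊕ Vertex ⊕ Vertex))
      fun v w h => by simpa using h
  have hset : {ω | ∀ x ∈ X, π x ω ∩ B x = ∅} = ⋂ x ∈ X, {ω | π x ω ∩ B x = ∅} := by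
    ext ω
    simp
  rw [hset, hind.meas_biInter fun x hx => measurableSet_inter_eq_empty (π x) (hB x hx) (h0 x hx),
    ← Finset.sum_neg_distrib, Real.exp_sum,
    ENNReal.ofReal_prod_of_nonneg fun _ _ => (Real.exp_pos _).le]
  refine Finset.prod_congr rfl fun x hx => ?_
  rw [(h.poisson x).measure_inter_eq_empty (hB x hx) (h0 x hx) (hv x hx)]
  simp [div_eq_inv_mul]

lemma measure_forall_not_posHits_of_pos (h : IsInput P n ν κ π) {k : Vertex → ℝ}
    (hk : ∀ v, 0 < k v) (Y : Finset Vertex) (S : Vertex → Finset Vertex) :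
    P {ω | ∀ y ∈ Y, ∀ z ∈ S y, ¬ PosHits k (fun v => π v ω) y z} =
      ∏ y ∈ Y, ENNReal.ofReal (Real.exp (-((S y).card / n * k y))) := by
  classical
  set X : Finset Vertex := Y.biUnion fun y => (S y).image (y ++ ·) with hX
  set E : Vertex → Finset Vertex := fun x => Y.filter fun y => x ∈ (S y).image (y ++ ·) with hE
  have hE_prefix : ∀ x, ∀ y ∈ E x, y <+: x := by
    intro x y hy
    obtain ⟨z, -, rfl⟩ := Finset.mem_image.1 (Finset.mem_filter.1 hy).2
    exact List.prefix_append y z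
  have hvol : ∀ x, volume (⋃ y ∈ E x, posEdge k y) = ENNReal.ofReal (∑ y ∈ E x, k y) :=
    fun x => volume_biUnion_posEdge hk (hE_prefix x)
  have hset : {ω | ∀ y ∈ Y, ∀ z ∈ S y, ¬ PosHits k (fun v => π v ω) y z} =
      {ω | ∀ x ∈ X, π x ω ∩ ⋃ y ∈ E x, posEdge k y = ∅} := by
    ext ω
    simp only [PosHits, Set.not_nonempty_iff_eq_empty, Set.inter_iUnion, Set.iUnion_eq_empty, hX,
      hE, Finset.mem_biUnion, Finset.mem_filter, Finset.mem_image, Set.mem_ofPred_eq]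
    constructor
    · rintro H _ - y ⟨hy, z, hz, rfl⟩
      exact H y hy z hz
    · exact fun H y hy z hz => H (y ++ z) ⟨y, hy, z, hz, rfl⟩ y ⟨hy, z, hz, rfl⟩
  rw [hset, h.measure_forall_inter_eq_empty X
    (fun x _ => Finset.measurableSet_biUnion _ fun y _ => measurableSet_posEdge k y)
    (fun x _ => Set.iUnion₂_subset fun y _ => posEdge_subset_Ioi k y) fun x _ => by simp [hvol],
    ← ENNReal.ofReal_prod_of_nonneg fun _ _ => (Real.exp_pos _).le, ← Real.exp_sum,
    Finset.sum_neg_distrib]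
  congr 3
  simp only [hvol, ENNReal.toReal_ofReal (Finset.sum_nonneg fun y _ => (hk y).le),
    Finset.sum_div]
  rw [Finset.sum_comm' (t' := Y) (s' := fun y => (S y).image (y ++ ·))]
  · refine Finset.sum_congr rfl fun y _ => ?_
    rw [Finset.sum_const, Finset.card_image_of_injective _ (List.append_right_injective y),
      nsmul_eq_mul]
    ring
  · intro x y
    simp only [hX, hE, Finset.mem_biUnion, Finset.mem_filter]
    tauto

lemma lintegral_prod_exp_lengths (h : IsInput P n ν κ π) (Y : Finset Vertex) {s : Vertex → ℝ}
    (hs : ∀ y, 0 ≤ s y) :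
    ∫⁻ ω, ∏ y ∈ Y, ENNReal.ofReal (Real.exp (-(s y * κ y ω))) ∂P =
      ∏ y ∈ Y, ENNReal.ofReal (2 / (2 + s y)) := by
  have hind : iIndepFun (fun v ω => κ v ω) P := by
    rw [iIndepFun_iff_iIndep]
    exact h.indep.precomp (g := fun v : Vertex => .inr (.inl v)) fun v w h => by simpa using h
  have hexp : ∀ y, Measurable fun x : ℝ => ENNReal.ofReal (Real.exp (-(s y * x))) := by
    intro y
    fun_prop
  rw [lintegral_prod_eq_prod_lintegral_of_indepFun Y
    (fun y ω => ENNReal.ofReal (Real.exp (-(s y * κ y ω)))) (hind.comp _ hexp)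
    fun y => (hexp y).comp (h.measurable_length y)]
  refine Finset.prod_congr rfl fun y _ => ?_
  rw [← lintegral_map (f := fun x => ENNReal.ofReal (Real.exp (-(s y * x)))) (hexp y)
    (h.measurable_length y), h.length_law, lintegral_exp_neg_mul_expMeasure (hs y)]

theorem measure_forall_not_posHits (h : IsInput P n ν κ π) [IsProbabilityMeasure P]
    (Y : Finset Vertex) (S : Vertex → Finset Vertex) :
    P {ω | ∀ y ∈ Y, ∀ z ∈ S y, ¬ PosHits (fun v => κ v ω) (fun v => π v ω) y z} =
      ∏ y ∈ Y, ENNReal.ofReal (2 / (2 + (S y).card / n)) := by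
  set D : Set ((Vertex → ℝ) × (Vertex → ℚ → ℚ → Prop)) :=
    {p | ∀ y ∈ Y, ∀ z ∈ S y, ¬ RatHits p.1 p.2 y z} with hD
  have hDm : MeasurableSet D := by
    refine Measurable.setOf (Measurable.forall fun y => measurable_const.imp ?_)
    exact Measurable.forall fun z => measurable_const.imp (measurable_ratHits y z).not
  have hκ := h.measurable_lengths
  have hπ := h.measurable_ratPoints
  have hlaw : P {ω | ∀ y ∈ Y, ∀ z ∈ S y, ¬ PosHits (fun v => κ v ω) (fun v => π v ω) y z} =
      P.map (fun ω => ((fun v => κ v ω), ratPoints fun v => π v ω)) D := by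
    rw [Measure.map_apply (hκ.prodMk hπ) hDm]
    simp [hD, ratHits_ratPoints]
  have hfixed : ∀ᵐ ω ∂P, (P.map fun ω => ratPoints fun v => π v ω)
      (Prod.mk (fun v => κ v ω) ⁻¹' D) =
      ∏ y ∈ Y, ENNReal.ofReal (Real.exp (-((S y).card / n * κ y ω))) := by
    filter_upwards [h.ae_length_pos] with ω hω
    rw [Measure.map_apply hπ (measurable_prodMk_left hDm),
      ← h.measure_forall_not_posHits_of_pos hω Y S]
    simp [hD, ratHits_ratPoints]
  have : IsProbabilityMeasure (P.map fun ω => ratPoints fun v => π v ω) :=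
    Measure.isProbabilityMeasure_map hπ.aemeasurable
  rw [hlaw, h.indepFun_lengths_ratPoints.map_prod_eq_prod_map_map hκ.aemeasurable hπ.aemeasurable,
    Measure.prod_apply hDm, lintegral_map (measurable_measure_prodMk_left hDm) hκ,
    lintegral_congr_ae hfixed, h.lintegral_prod_exp_lengths Y fun y => by positivity]

end IsInput
end Input

/-! ### The independent building blocks of the pruned tree -/

lemma iIndep_sum {Ω ι ι' : Type*} {_ : MeasurableSpace Ω} {μ : Measure Ω}
    {m : ι ⊕ ι' → MeasurableSpace Ω} (hl : iIndep (fun i => m (.inl i)) μ)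
    (hr : iIndep (fun i => m (.inr i)) μ)
    (hlr : Indep (⨆ i, m (.inl i)) (⨆ i, m (.inr i)) μ) : iIndep m μ := by
  rw [iIndep_iff]
  intro s f hf
  have hfl : ∀ i ∈ s.toLeft, MeasurableSet[m (.inl i)] (f (.inl i)) :=
    fun i hi => hf _ (Finset.mem_toLeft.1 hi)
  have hfr : ∀ i ∈ s.toRight, MeasurableSet[m (.inr i)] (f (.inr i)) :=
    fun i hi => hf _ (Finset.mem_toRight.1 hi)
  have hsplit : ⋂ i ∈ s, f i =
      (⋂ i ∈ s.toLeft, f (.inl i)) ∩ ⋂ i ∈ s.toRight, f (.inr i) := by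
    ext ω
    simp
  have hml : MeasurableSet[⨆ i, m (.inl i)] (⋂ i ∈ s.toLeft, f (.inl i)) :=
    @Finset.measurableSet_biInter _ _ (⨆ i, m (.inl i)) _ _ fun i hi =>
      le_iSup (fun i => m (.inl i)) i _ (hfl i hi)
  have hmr : MeasurableSet[⨆ i, m (.inr i)] (⋂ i ∈ s.toRight, f (.inr i)) :=
    @Finset.measurableSet_biInter _ _ (⨆ i, m (.inr i)) _ _ fun i hi =>
      le_iSup (fun i => m (.inr i)) i _ (hfr i hi)
  rw [hsplit, (Indep_iff _ _ _).1 hlr _ _ hml hmr, hl.meas_biInter hfl, hr.meas_biInter hfr]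
  conv_rhs => rw [← Finset.toLeft_disjSum_toRight (u := s), Finset.prod_disjSum]

lemma spine_or_planted_or_offspring_eq_zero (v : Vertex) :
    (∃ i, v = spine i) ∨ (∃ i w, v = spine i ++ 0 :: w) ∨ ∀ ν, offspring ν v = 0 := by
  induction v with
  | nil => exact Or.inl ⟨0, rfl⟩
  | cons j w ih =>
    rcases j with _ | _ | j
    · exact Or.inr (Or.inl ⟨0, w, rfl⟩)
    · rcases ih with ⟨i, rfl⟩ | ⟨i, u, rfl⟩ | h
      · exact Or.inl ⟨i + 1, rfl⟩
      · exact Or.inr (Or.inl ⟨i + 1, u, rfl⟩)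
      · exact Or.inr (Or.inr fun ν => h _)
    · exact Or.inr (Or.inr fun ν => rfl)

/-- The index of the building blocks: offspring numbers of the planted trees, and edges. -/
abbrev BlockIndex := (ℕ × Vertex) ⊕ Vertex

/-- The vertex to which a building block is attached. -/
def blockVertex : BlockIndex → Vertex
  | .inl p => spine p.1 ++ 0 :: p.2
  | .inr y => y

/-- The building blocks attached to the vertices above `v`. -/
def blocksAbove (v : Vertex) : Set BlockIndex := {i | v <+: blockVertex i}

/-- The offspring number of `v`, if any. -/
def offspringBlock (v : Vertex) : Set BlockIndex := {i | ∃ p, i = .inl p ∧ blockVertex i = v}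

lemma blocksAbove_mono {v w : Vertex} (h : v <+: w) : blocksAbove w ⊆ blocksAbove v :=
  fun _ hi => h.trans hi

lemma offspringBlock_subset (v : Vertex) : offspringBlock v ⊆ blocksAbove v := by
  rintro i ⟨p, -, h⟩
  rw [blocksAbove, Set.mem_ofPred_eq, h]

lemma disjoint_blocksAbove (v : Vertex) :
    Disjoint (blocksAbove (v ++ [0])) (blocksAbove (v ++ [1])) := by
  rw [Set.disjoint_left]
  intro i h0 h1
  have := List.prefix_of_prefix_length_le h0 h1 (by simp)
  have := this.eq_of_length (by simp)
  simp at this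

lemma disjoint_blocksAbove_offspringBlock (v : Vertex) :
    Disjoint (blocksAbove (v ++ [0]) ∪ blocksAbove (v ++ [1])) (offspringBlock v) := by
  rw [Set.disjoint_left]
  rintro i h ⟨p, -, rfl⟩
  rcases h with h | h <;>
  · have := List.IsPrefix.length_le h
    simp at this

lemma disjoint_edgeBlock (v : Vertex) :
    Disjoint ((blocksAbove (v ++ [0]) ∪ blocksAbove (v ++ [1])) ∪ offspringBlock v)
      {(.inr v : BlockIndex)} := by
  rw [Set.disjoint_singleton_right]
  rintro ((h | h) | ⟨p, h, -⟩)
  · have := List.IsPrefix.length_le h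
    simp [blockVertex] at this
  · have := List.IsPrefix.length_le h
    simp [blockVertex] at this
  · simp at h

section Blocks

variable {Ω : Type*} {ν : ℕ → Vertex → Ω → ℕ} {κ : Vertex → Ω → ℝ} {π : Vertex → Ω → Set ℝ}

/-- None of the vertices `y ++ z`, `z ∈ S`, sends a mark to the edge `y`. -/
def noHits (κ : Vertex → Ω → ℝ) (π : Vertex → Ω → Set ℝ) (y : Vertex) (S : Finset Vertex) :
    Set Ω :=
  {ω | ∀ z ∈ S, ¬ PosHits (fun v => κ v ω) (fun v => π v ω) y z}

/-- The `σ`-algebra generated by the events that given vertices send no mark to the edge `y`. -/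
@[reducible] def edgeSigma (κ : Vertex → Ω → ℝ) (π : Vertex → Ω → Set ℝ) (y : Vertex) :
    MeasurableSpace Ω :=
  MeasurableSpace.generateFrom (Set.range (noHits κ π y))

/-- The `σ`-algebras generated by the building blocks: an offspring number, or the marks received by
an edge. -/
@[reducible] def blockSigma (ν : ℕ → Vertex → Ω → ℕ) (κ : Vertex → Ω → ℝ) (π : Vertex → Ω → Set ℝ) :
    BlockIndex → MeasurableSpace Ω
  | .inl p => MeasurableSpace.comap (ν p.1 p.2) inferInstance
  | .inr y => edgeSigma κ π y

/-- The `σ`-algebra generated by the building blocks in `S`. -/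
@[reducible] def blocksSigma (ν : ℕ → Vertex → Ω → ℕ) (κ : Vertex → Ω → ℝ) (π : Vertex → Ω → Set ℝ)
    (S : Set BlockIndex) : MeasurableSpace Ω :=
  ⨆ i ∈ S, blockSigma ν κ π i

lemma blockSigma_le_blocksSigma {S : Set BlockIndex} {i : BlockIndex} (hi : i ∈ S) :
    blockSigma ν κ π i ≤ blocksSigma ν κ π S :=
  le_iSup₂_of_le i hi le_rfl

lemma blocksSigma_mono {S S' : Set BlockIndex} (h : S ⊆ S') :
    blocksSigma ν κ π S ≤ blocksSigma ν κ π S' :=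
  biSup_mono h

lemma isPiSystem_noHits (κ : Vertex → Ω → ℝ) (π : Vertex → Ω → Set ℝ) (y : Vertex) :
    IsPiSystem (Set.range (noHits κ π y)) := by
  classical
  rintro _ ⟨S, rfl⟩ _ ⟨S', rfl⟩ -
  refine ⟨S ∪ S', ?_⟩
  ext ω
  simp only [noHits, Finset.mem_union, Set.mem_ofPred_eq, Set.mem_inter_iff]
  constructor
  · exact fun h => ⟨fun z hz => h z (Or.inl hz), fun z hz => h z (Or.inr hz)⟩
  · rintro ⟨h, h'⟩ z (hz | hz)
    exacts [h z hz, h' z hz]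

lemma measurable_posHits_blockSigma (y z : Vertex) :
    Measurable[blockSigma ν κ π (.inr y)]
      fun ω => PosHits (fun v => κ v ω) (fun v => π v ω) y z := by
  refine (@measurableSet_setOfPred _ (blockSigma ν κ π (.inr y)) _).1 ?_
  have : MeasurableSet[blockSigma ν κ π (.inr y)] (noHits κ π y {z}) :=
    MeasurableSpace.measurableSet_generateFrom ⟨{z}, rfl⟩
  convert this.compl using 1
  ext ω
  simp [noHits]

lemma measurable_offspring (v : Vertex) :
    Measurable[blocksSigma ν κ π (offspringBlock v)]
      fun ω => offspring (fun i u => ν i u ω) v := by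
  rcases spine_or_planted_or_offspring_eq_zero v with ⟨i, rfl⟩ | ⟨i, w, rfl⟩ | h
  · simp only [offspring_spine]
    exact measurable_const
  · simp only [offspring_planted]
    refine Measurable.mono (comap_measurable (ν i w)) ?_ le_rfl
    exact blockSigma_le_blocksSigma (ν := ν) (κ := κ) (π := π) (i := .inl (i, w))
      ⟨(i, w), rfl, rfl⟩
  · simp only [h]
    exact measurable_const

end Blocks

section Input

variable {Ω : Type*} [mΩ : MeasurableSpace Ω] {P : Measure Ω} {n : ℕ}
  {ν : ℕ → Vertex → Ω → ℕ} {κ : Vertex → Ω → ℝ} {π : Vertex → Ω → Set ℝ}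

lemma measurable_posHits (hκ : ∀ v, Measurable (κ v)) (hπ : ∀ v, pointSigma (π v) ≤ mΩ)
    (y z : Vertex) :
    Measurable fun ω => PosHits (fun v => κ v ω) (fun v => π v ω) y z := by
  have := (measurable_ratHits y z).comp
    ((measurable_pi_iff.2 hκ).prodMk (measurable_ratPoints π hπ))
  simpa only [Function.comp_def, ratHits_ratPoints] using this

lemma measurableSet_noHits (hκ : ∀ v, Measurable (κ v)) (hπ : ∀ v, pointSigma (π v) ≤ mΩ)
    (y : Vertex) (S : Finset Vertex) : MeasurableSet (noHits κ π y S) :=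
  Measurable.setOf <| Measurable.forall fun z => measurable_const.imp
    (measurable_posHits hκ hπ y z).not

namespace IsInput

lemma measure_noHits (h : IsInput P n ν κ π) [IsProbabilityMeasure P] (y : Vertex)
    (S : Finset Vertex) : P (noHits κ π y S) = ENNReal.ofReal (2 / (2 + S.card / n)) := by
  have := h.measure_forall_not_posHits {y} fun _ => S
  simpa [noHits] using this

lemma blockSigma_le (h : IsInput P n ν κ π) (i : BlockIndex) : blockSigma ν κ π i ≤ mΩ := by
  rcases i with p | y
  · exact (h.measurable_offspring _ _).comap_le
  · refine MeasurableSpace.generateFrom_le ?_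
    rintro _ ⟨S, rfl⟩
    exact measurableSet_noHits h.measurable_length (fun v => h.inputSigma_le (.inr (.inr v))) y S

lemma blocksSigma_le (h : IsInput P n ν κ π) (S : Set BlockIndex) : blocksSigma ν κ π S ≤ mΩ :=
  iSup₂_le fun i _ => h.blockSigma_le i

lemma iIndep_edgeSigma (h : IsInput P n ν κ π) [IsProbabilityMeasure P] :
    iIndep (edgeSigma κ π) P := by
  refine iIndepSets.iIndep (fun y => h.blockSigma_le (.inr y)) (fun y => Set.range (noHits κ π y))
    (isPiSystem_noHits κ π) (fun _ => rfl) ((iIndepSets_iff _ _).2 fun Y f hf => ?_)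
  choose! S hS using hf
  have hY : ⋂ y ∈ Y, f y =
      {ω | ∀ y ∈ Y, ∀ z ∈ S y, ¬ PosHits (fun v => κ v ω) (fun v => π v ω) y z} := by
    ext ω
    simp only [Set.mem_iInter, Set.mem_ofPred_eq]
    refine forall₂_congr fun y hy => ?_
    rw [← hS y hy]
    rfl
  rw [hY, h.measure_forall_not_posHits]
  exact Finset.prod_congr rfl fun y hy => by rw [← hS y hy, h.measure_noHits]

lemma indep_offspring_edges (h : IsInput P n ν κ π) :
    Indep (⨆ p : ℕ × Vertex, blockSigma ν κ π (.inl p)) (⨆ y, edgeSigma κ π y) P := by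
  have hd : Disjoint
      (Set.range fun p : ℕ × Vertex => (.inl p : (ℕ × Vertex) ⊕ Vertex ⊕ Vertex))
      (Set.range fun v : Vertex ⊕ Vertex => .inr v) := by
    rw [Set.disjoint_left]
    rintro _ ⟨v, rfl⟩ ⟨w, hw⟩
    simp at hw
  have hind := indep_iSup_of_disjoint h.inputSigma_le h.indep hd
  rw [iSup_range, iSup_range] at hind
  refine indep_of_indep_of_le_right hind (iSup_le fun y => MeasurableSpace.generateFrom_le ?_)
  rintro _ ⟨S, rfl⟩
  refine @measurableSet_noHits _ (⨆ i, inputSigma ν κ π (.inr i)) κ π (fun v => ?_)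
    (fun v => le_iSup (fun i => inputSigma ν κ π (.inr i)) (.inr v)) y S
  exact (comap_measurable (κ v)).mono
    (le_iSup (fun i => inputSigma ν κ π (.inr i)) (.inl v)) le_rfl

lemma iIndep_blockSigma (h : IsInput P n ν κ π) [IsProbabilityMeasure P] :
    iIndep (blockSigma ν κ π) P :=
  iIndep_sum
    (h.indep.precomp (g := fun p : ℕ × Vertex => (.inl p : (ℕ × Vertex) ⊕ Vertex ⊕ Vertex))
      fun v w h => by simpa using h)
    h.iIndep_edgeSigma h.indep_offspring_edges

lemma indep_blocksSigma (h : IsInput P n ν κ π) [IsProbabilityMeasure P] {S S' : Set BlockIndex}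
    (hd : Disjoint S S') : Indep (blocksSigma ν κ π S) (blocksSigma ν κ π S') P :=
  indep_iSup_of_disjoint h.blockSigma_le h.iIndep_blockSigma hd

end IsInput
end Input

/-! ### Measurability of the recursion -/

instance : MeasurableSpace (Finset Vertex) := ⊤

instance : DiscreteMeasurableSpace (Finset Vertex) := ⟨fun _ => trivial⟩

lemma measurable_grow {Ω : Type*} [MeasurableSpace Ω] {k : Ω → ℕ} {a b : Ω → Finset Vertex}
    (hk : Measurable k) (ha : Measurable a) (hb : Measurable b) :
    Measurable fun ω => grow (k ω) (a ω) (b ω) :=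
  (measurable_of_countable fun p : ℕ × Finset Vertex × Finset Vertex =>
    grow p.1 p.2.1 p.2.2).comp (hk.prodMk (ha.prodMk hb))

lemma measurable_cutIf {Ω : Type*} [MeasurableSpace Ω] {B : Ω → Finset Vertex}
    {e : Ω → Vertex → Prop} (hB : Measurable B) (he : ∀ z, Measurable fun ω => e ω z) :
    Measurable fun ω => cutIf (e ω) (B ω) := by
  have hmem : ∀ z, Measurable fun ω => z ∈ B ω := fun z =>
    (measurable_of_countable fun S : Finset Vertex => z ∈ S).comp hB
  exact Measurable.ite (Measurable.exists fun z => (hmem z).and (he z)).setOf measurable_const hB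

lemma measurable_alive {Ω : Type*} {ν : ℕ → Vertex → Ω → ℕ} {κ : Vertex → Ω → ℝ}
    {π : Vertex → Ω → Set ℝ} (d : ℕ) (v : Vertex) :
    Measurable[blocksSigma ν κ π (blocksAbove v)] fun ω =>
      alive (offspring fun i u => ν i u ω) (PosHits (fun v => κ v ω) fun v => π v ω) d v := by
  induction d generalizing v with
  | zero => exact measurable_const
  | succ d ih =>
    refine @measurable_cutIf _ (blocksSigma ν κ π (blocksAbove v)) _ _
      (@measurable_grow _ (blocksSigma ν κ π (blocksAbove v)) _ _ _ ?_ ?_ ?_) fun z => ?_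
    · exact (measurable_offspring v).mono (blocksSigma_mono (offspringBlock_subset v)) le_rfl
    · exact (ih _).mono (blocksSigma_mono (blocksAbove_mono (List.prefix_append _ _))) le_rfl
    · exact (ih _).mono (blocksSigma_mono (blocksAbove_mono (List.prefix_append _ _))) le_rfl
    · exact (measurable_posHits_blockSigma v z).mono
        (blockSigma_le_blocksSigma (List.prefix_refl v)) le_rfl

lemma measurable_terminates {Ω : Type*} {ν : ℕ → Vertex → Ω → ℕ} {κ : Vertex → Ω → ℝ}
    {π : Vertex → Ω → Set ℝ} (d : ℕ) (v : Vertex) :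
    Measurable[blocksSigma ν κ π (blocksAbove v)] fun ω =>
      Terminates (fun v => offspring (fun i u => ν i u ω) v ≠ 2) d v := by
  have h0 : ∀ v, Measurable[blocksSigma ν κ π (blocksAbove v)] fun ω =>
      offspring (fun i u => ν i u ω) v ≠ 2 := fun v =>
    (measurable_of_countable fun k : ℕ => k ≠ 2).comp
      ((measurable_offspring v).mono (blocksSigma_mono (offspringBlock_subset v)) le_rfl)
  induction d generalizing v with
  | zero => exact h0 v
  | succ d ih =>
    let := blocksSigma ν κ π (blocksAbove v)
    refine (h0 v).or (.and ?_ ?_)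
    · exact (ih _).mono (blocksSigma_mono (blocksAbove_mono (List.prefix_append _ _))) le_rfl
    · exact (ih _).mono (blocksSigma_mono (blocksAbove_mono (List.prefix_append _ _))) le_rfl

/-! ### Recursion for the law of the number of alive nodes -/

open scoped ENNReal
open Finset.HasAntidiagonal (antidiagonal mem_antidiagonal)

section

lemma preimage_cutIf_singleton {Ω : Type*} (B : Ω → Finset Vertex) (e : Ω → Vertex → Prop)
    {S : Finset Vertex} (hS : S ≠ ∅) :
    (fun ω => cutIf (e ω) (B ω)) ⁻¹' {S} = B ⁻¹' {S} ∩ {ω | ∀ z ∈ S, ¬ e ω z} := by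
  ext ω
  simp only [Set.mem_preimage, Set.mem_singleton_iff, Set.mem_inter_iff, Set.mem_ofPred_eq, cutIf]
  split_ifs with hc
  · obtain ⟨z, hz, hez⟩ := hc
    refine iff_of_false hS.symm ?_
    rintro ⟨rfl, h⟩
    exact h z hz hez
  · push Not at hc
    exact ⟨fun h => ⟨h, h ▸ hc⟩, fun h => h.1⟩

variable {Ω : Type*} {m₁ m₂ m₃ : MeasurableSpace Ω} [mΩ : MeasurableSpace Ω] {P : Measure Ω}

lemma measure_card_cutIf (h₁ : m₁ ≤ mΩ) (h₂ : m₂ ≤ mΩ) (hind : Indep m₁ m₂ P)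
    {B : Ω → Finset Vertex} (hB : Measurable[m₁] B) {e : Ω → Vertex → Prop}
    (he : ∀ S : Finset Vertex, MeasurableSet[m₂] {ω | ∀ z ∈ S, ¬ e ω z})
    {φ : ℕ → ℝ≥0∞} (hφ : ∀ S : Finset Vertex, P {ω | ∀ z ∈ S, ¬ e ω z} = φ S.card) (k : ℕ) :
    P {ω | (cutIf (e ω) (B ω)).card = k + 1} = φ (k + 1) * P {ω | (B ω).card = k + 1} := by
  have hBS : ∀ S, MeasurableSet[m₁] (B ⁻¹' {S}) := fun S => hB (measurableSet_singleton S)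
  have hcut : ∀ S ∈ {S : Finset Vertex | S.card = k + 1},
      (fun ω => cutIf (e ω) (B ω)) ⁻¹' {S} = B ⁻¹' {S} ∩ {ω | ∀ z ∈ S, ¬ e ω z} := by
    intro S hS
    refine preimage_cutIf_singleton B e (Finset.card_pos.1 ?_).ne_empty
    exact k.succ_pos.trans_eq (Eq.symm hS)
  have hfib := tsum_measure_preimage_singleton (μ := P) (Set.to_countable _) fun S hS =>
    (hcut S hS) ▸ (h₁ _ (hBS S)).inter (h₂ _ (he S))
  have hfib' := tsum_measure_preimage_singleton (μ := P) (f := B)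
    (Set.to_countable {S : Finset Vertex | S.card = k + 1}) fun S _ => h₁ _ (hBS S)
  refine hfib.symm.trans (.trans ?_ (congrArg _ hfib'))
  rw [← ENNReal.tsum_mul_left]
  refine tsum_congr fun S => ?_
  rw [hcut S S.2, (Indep_iff _ _ _).1 hind _ _ (hBS S) (he S), hφ, S.2, mul_comm]

lemma measure_card_grow (h₁ : m₁ ≤ mΩ) (h₂ : m₂ ≤ mΩ) (hind : Indep m₁ m₂ P)
    (hind' : Indep (m₁ ⊔ m₂) m₃ P) {a b : Ω → Finset Vertex} {N : Ω → ℕ}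
    (ha : Measurable[m₁] a) (hb : Measurable[m₂] b) (hN : Measurable[m₃] N) (k : ℕ) :
    P {ω | (grow (N ω) (a ω) (b ω)).card = k + 1} =
      P {ω | N ω = 2} * ∑ p ∈ antidiagonal k,
        P {ω | (a ω).card = p.1} * P {ω | (b ω).card = p.2} := by
  have hA : ∀ i, MeasurableSet[m₁] {ω | (a ω).card = i} := fun i =>
    ha (MeasurableSet.of_discrete (s := {s : Finset Vertex | s.card = i}))
  have hB : ∀ i, MeasurableSet[m₂] {ω | (b ω).card = i} := fun i =>
    hb (MeasurableSet.of_discrete (s := {s : Finset Vertex | s.card = i}))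
  have hC : MeasurableSet[m₃] {ω | N ω = 2} := hN (measurableSet_singleton 2)
  set f : Ω → ℕ × ℕ := fun ω => ((a ω).card, (b ω).card) with hf
  have hfp : ∀ p, f ⁻¹' {p} = {ω | (a ω).card = p.1} ∩ {ω | (b ω).card = p.2} := fun p => by
    ext ω
    simp [hf, Prod.ext_iff]
  have hfm : ∀ p, MeasurableSet[m₁ ⊔ m₂] (f ⁻¹' {p}) := fun p => by
    rw [hfp]
    exact ((le_sup_left : m₁ ≤ m₁ ⊔ m₂) _ (hA p.1)).inter ((le_sup_right : m₂ ≤ m₁ ⊔ m₂) _ (hB p.2))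
  have hset : {ω | (grow (N ω) (a ω) (b ω)).card = k + 1} =
      f ⁻¹' (antidiagonal k) ∩ {ω | N ω = 2} := by
    ext ω
    by_cases h2 : N ω = 2 <;> simp [grow, h2, card_graft, hf, mem_antidiagonal]
  have hfk : MeasurableSet[m₁ ⊔ m₂] (f ⁻¹' (antidiagonal k)) := by
    rw [← Set.biUnion_preimage_singleton]
    exact @Finset.measurableSet_biUnion _ _ (m₁ ⊔ m₂) _ _ fun p _ => hfm p
  rw [hset, (Indep_iff _ _ _).1 hind' _ _ hfk hC, mul_comm,
    ← sum_measure_preimage_singleton _ fun p _ => sup_le h₁ h₂ _ (hfm p)]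
  congr 1
  refine Finset.sum_congr rfl fun p _ => ?_
  rw [hfp, (Indep_iff _ _ _).1 hind _ _ (hA p.1) (hB p.2)]

lemma measure_eq_congr_of_succ [IsProbabilityMeasure P] {X Y : Ω → ℕ} (hX : Measurable X)
    (hY : Measurable Y) (h : ∀ k, P {ω | X ω = k + 1} = P {ω | Y ω = k + 1}) (k : ℕ) :
    P {ω | X ω = k} = P {ω | Y ω = k} := by
  have htotal : ∀ Z : Ω → ℕ, Measurable Z →
      P {ω | Z ω = 0} + ∑' k, P {ω | Z ω = k + 1} = 1 := by
    intro Z hZ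
    have hfib := tsum_measure_preimage_singleton (μ := P) (f := Z) Set.countable_univ
      fun k _ => hZ (measurableSet_singleton k)
    rw [tsum_univ fun k => P (Z ⁻¹' {k}), Set.preimage_univ, measure_univ] at hfib
    exact (tsum_eq_zero_add' (f := fun k => P (Z ⁻¹' {k})) ENNReal.summable).symm.trans hfib
  rcases k with _ | k
  · have hXY := (htotal X hX).trans (htotal Y hY).symm
    simp only [h] at hXY
    refine (ENNReal.add_left_inj (ne_top_of_le_ne_top ENNReal.one_ne_top ?_)).1 hXY
    exact le_add_self.trans (htotal Y hY).le
  · exact h k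

end

section Input

variable {Ω : Type*} [mΩ : MeasurableSpace Ω] {P : Measure Ω} {n : ℕ}
  {ν : ℕ → Vertex → Ω → ℕ} {κ : Vertex → Ω → ℝ} {π : Vertex → Ω → Set ℝ}

/-- The number of alive nodes above `v` in the pruning of the tree truncated `d` generations
above `v`. -/
noncomputable def aliveCard (ν : ℕ → Vertex → Ω → ℕ) (κ : Vertex → Ω → ℝ) (π : Vertex → Ω → Set ℝ)
    (d : ℕ) (v : Vertex) (ω : Ω) : ℕ :=
  (alive (offspring fun i u => ν i u ω) (PosHits (fun v => κ v ω) fun v => π v ω) d v).card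

namespace IsInput

lemma measurable_aliveCard (h : IsInput P n ν κ π) (d : ℕ) (v : Vertex) :
    Measurable (aliveCard ν κ π d v) :=
  (measurable_of_countable Finset.card).comp
    ((measurable_alive d v).mono (h.blocksSigma_le _) le_rfl)

lemma measure_offspring_planted (h : IsInput P n ν κ π) (i : ℕ) (w : Vertex) :
    P {ω | offspring (fun i u => ν i u ω) (spine i ++ 0 :: w) = 2} = 1 / 2 := by
  simp only [offspring_planted]
  exact h.offspring_two i w

variable [IsProbabilityMeasure P]

lemma indep_children (h : IsInput P n ν κ π) (v : Vertex) :
    Indep (blocksSigma ν κ π (blocksAbove (v ++ [0])))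
      (blocksSigma ν κ π (blocksAbove (v ++ [1]))) P :=
  h.indep_blocksSigma (disjoint_blocksAbove v)

lemma indep_offspring (h : IsInput P n ν κ π) (v : Vertex) :
    Indep (blocksSigma ν κ π (blocksAbove (v ++ [0])) ⊔ blocksSigma ν κ π (blocksAbove (v ++ [1])))
      (blocksSigma ν κ π (offspringBlock v)) P := by
  have := h.indep_blocksSigma (disjoint_blocksAbove_offspringBlock v)
  rwa [blocksSigma, iSup_union] at this

lemma measure_aliveCard_succ (h : IsInput P n ν κ π) (d : ℕ) (v : Vertex) (k : ℕ) :
    P {ω | aliveCard ν κ π (d + 1) v ω = k + 1} =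
      ENNReal.ofReal (2 / (2 + (k + 1 : ℕ) / n)) *
        (P {ω | offspring (fun i u => ν i u ω) v = 2} * ∑ p ∈ antidiagonal k,
          P {ω | aliveCard ν κ π d (v ++ [0]) ω = p.1} *
          P {ω | aliveCard ν κ π d (v ++ [1]) ω = p.2}) := by
  set S : Set BlockIndex := (blocksAbove (v ++ [0]) ∪ blocksAbove (v ++ [1])) ∪ offspringBlock v
  have h0 : blocksSigma ν κ π (blocksAbove (v ++ [0])) ≤ blocksSigma ν κ π S :=
    blocksSigma_mono fun i hi => Or.inl (Or.inl hi)
  have h1 : blocksSigma ν κ π (blocksAbove (v ++ [1])) ≤ blocksSigma ν κ π S :=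
    blocksSigma_mono fun i hi => Or.inl (Or.inr hi)
  have h2 : blocksSigma ν κ π (offspringBlock v) ≤ blocksSigma ν κ π S :=
    blocksSigma_mono fun i hi => Or.inr hi
  have hg := @measurable_grow _ (blocksSigma ν κ π S) _ _ _
    ((ForestFire.measurable_offspring (ν := ν) (κ := κ) (π := π) v).mono h2 le_rfl)
    ((measurable_alive (ν := ν) (κ := κ) (π := π) d (v ++ [0])).mono h0 le_rfl)
    ((measurable_alive (ν := ν) (κ := κ) (π := π) d (v ++ [1])).mono h1 le_rfl)
  have hcut := measure_card_cutIf (P := P) (h.blocksSigma_le S) (h.blocksSigma_le {(.inr v)})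
    (h.indep_blocksSigma (disjoint_edgeBlock v)) hg
    (e := fun ω => PosHits (fun v => κ v ω) (fun v => π v ω) v)
    (φ := fun k => ENNReal.ofReal (2 / (2 + k / n)))
    (fun T => blockSigma_le_blocksSigma (ν := ν) (κ := κ) (π := π) (Set.mem_singleton _) _
      (MeasurableSpace.measurableSet_generateFrom (Set.mem_range_self T)))
    (fun T => h.measure_noHits v T) k
  refine hcut.trans ?_
  rw [measure_card_grow (h.blocksSigma_le _) (h.blocksSigma_le _)
    (h.indep_children v) (h.indep_offspring v) (measurable_alive d (v ++ [0]))
    (measurable_alive d (v ++ [1])) (ForestFire.measurable_offspring v)]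
  rfl

lemma measure_offspring_spine (i : ℕ) :
    P {ω | offspring (fun i u => ν i u ω) (spine i) = 2} = 1 := by
  simp [offspring_spine]

lemma measure_aliveCard_succ_congr (h : IsInput P n ν κ π) {d : ℕ} {v v' : Vertex}
    (hN : P {ω | offspring (fun i u => ν i u ω) v = 2} =
      P {ω | offspring (fun i u => ν i u ω) v' = 2})
    (h0 : ∀ k, P {ω | aliveCard ν κ π d (v ++ [0]) ω = k} =
      P {ω | aliveCard ν κ π d (v' ++ [0]) ω = k})
    (h1 : ∀ k, P {ω | aliveCard ν κ π d (v ++ [1]) ω = k} =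
      P {ω | aliveCard ν κ π d (v' ++ [1]) ω = k}) (k : ℕ) :
    P {ω | aliveCard ν κ π (d + 1) v ω = k} = P {ω | aliveCard ν κ π (d + 1) v' ω = k} :=
  measure_eq_congr_of_succ (h.measurable_aliveCard _ _) (h.measurable_aliveCard _ _)
    (fun k => by simp only [h.measure_aliveCard_succ, hN, h0, h1]) k

lemma measure_aliveCard_planted (h : IsInput P n ν κ π) (d : ℕ) (i : ℕ) (w : Vertex) (k : ℕ) :
    P {ω | aliveCard ν κ π d (spine i ++ 0 :: w) ω = k} = P {ω | aliveCard ν κ π d [0] ω = k} := by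
  induction d generalizing i w k with
  | zero => rfl
  | succ d ih =>
    have hchild : ∀ j k, P {ω | aliveCard ν κ π d ((spine i ++ 0 :: w) ++ [j]) ω = k} =
        P {ω | aliveCard ν κ π d ([0] ++ [j]) ω = k} := fun j k => by
      rw [List.append_assoc]
      exact (ih i (w ++ [j]) k).trans (ih 0 [j] k).symm
    exact h.measure_aliveCard_succ_congr
      ((h.measure_offspring_planted i w).trans (h.measure_offspring_planted 0 []).symm)
      (hchild 0) (hchild 1) k

lemma measure_aliveCard_spine (h : IsInput P n ν κ π) (d : ℕ) (i : ℕ) (k : ℕ) :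
    P {ω | aliveCard ν κ π d (spine i) ω = k} = P {ω | aliveCard ν κ π d [] ω = k} := by
  induction d generalizing i k with
  | zero => rfl
  | succ d ih =>
    refine h.measure_aliveCard_succ_congr
      ((measure_offspring_spine i).trans (measure_offspring_spine 0).symm)
      (fun k => h.measure_aliveCard_planted d i [] k) (fun k => ?_) k
    rw [spine_concat]
    exact (ih (i + 1) k).trans (ih 1 k).symm

lemma measure_aliveCard_planted_succ (h : IsInput P n ν κ π) (d : ℕ) (k : ℕ) :
    P {ω | aliveCard ν κ π (d + 1) [0] ω = k + 1} =
      ENNReal.ofReal (2 / (2 + (k + 1 : ℕ) / n)) *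
        (1 / 2 * ∑ p ∈ antidiagonal k,
          P {ω | aliveCard ν κ π d [0] ω = p.1} * P {ω | aliveCard ν κ π d [0] ω = p.2}) := by
  have h0 : P {ω | offspring (fun i u => ν i u ω) [0] = 2} = 1 / 2 :=
    h.measure_offspring_planted 0 []
  have e0 : ∀ j k, P {ω | aliveCard ν κ π d [0, j] ω = k} =
      P {ω | aliveCard ν κ π d [0] ω = k} := fun j k => h.measure_aliveCard_planted d 0 [j] k
  rw [h.measure_aliveCard_succ, h0]
  simp only [List.cons_append, List.nil_append, e0]

lemma measure_aliveCard_spine_succ (h : IsInput P n ν κ π) (d : ℕ) (k : ℕ) :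
    P {ω | aliveCard ν κ π (d + 1) [] ω = k + 1} =
      ENNReal.ofReal (2 / (2 + (k + 1 : ℕ) / n)) * ∑ p ∈ antidiagonal k,
          P {ω | aliveCard ν κ π d [0] ω = p.1} * P {ω | aliveCard ν κ π d [] ω = p.2} := by
  have h0 : P {ω | offspring (fun i u => ν i u ω) [] = 2} = 1 := measure_offspring_spine 0
  have e0 : ∀ k, P {ω | aliveCard ν κ π d [1] ω = k} =
      P {ω | aliveCard ν κ π d [] ω = k} := fun k => h.measure_aliveCard_spine d 1 k
  rw [h.measure_aliveCard_succ, h0, one_mul]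
  simp only [e0, List.nil_append]

end IsInput
end Input

/-! ### Almost sure regularity of the input -/

open Filter Topology

lemma IsPoissonPointProcess.ae_finite_inter {Ω : Type*} [MeasurableSpace Ω] {P : Measure Ω}
    [IsProbabilityMeasure P] {r : ℝ≥0} {N : Ω → Set ℝ} (h : IsPoissonPointProcess P r N)
    {B : Set ℝ} (hB : MeasurableSet B) (hpos : B ⊆ Set.Ioi 0) (hfin : volume B ≠ ⊤) :
    ∀ᵐ ω ∂P, (N ω ∩ B).Finite := by
  have hm : ∀ k : ℕ, MeasurableSet {ω | (N ω ∩ B).encard = k} := fun k =>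
    h.measurable_count B hB hpos (MeasurableSet.of_discrete (s := {(k : ℕ∞)}))
  have hdisj : Pairwise (Function.onFun Disjoint fun k : ℕ => {ω | (N ω ∩ B).encard = k}) :=
    fun i j hij => Set.disjoint_left.2 fun ω hi hj =>
      hij (Nat.cast_injective (hi.symm.trans hj : (i : ℕ∞) = j))
  have hone : P (⋃ k : ℕ, {ω | (N ω ∩ B).encard = k}) = 1 := by
    set μ := poissonMeasure (r * (volume B).toNNReal)
    calc P (⋃ k : ℕ, {ω | (N ω ∩ B).encard = k})
      _ = ∑' k : ℕ, μ {k} := by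
        rw [measure_iUnion hdisj hm]
        exact tsum_congr (h.count_law B hB hpos hfin)
      _ = μ (⋃ k, {k}) := (measure_iUnion (fun i j hij => Set.disjoint_singleton.2 hij)
        fun k => measurableSet_singleton k).symm
      _ = 1 := by rw [Set.iUnion_of_singleton, measure_univ]
  filter_upwards [(mem_ae_iff_prob_eq_one (MeasurableSet.iUnion hm)).2 hone] with ω hω
  obtain ⟨k, hk⟩ := Set.mem_iUnion.1 hω
  exact Set.finite_of_encard_eq_coe hk

/-- The probability that a critical binary Galton-Watson tree has height at most `d`. -/
noncomputable def extinctionSeq : ℕ → ℝ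
  | 0 => 1 / 2
  | d + 1 => 1 / 2 + extinctionSeq d ^ 2 / 2

lemma extinctionSeq_mem_Icc (d : ℕ) : extinctionSeq d ∈ Set.Icc (0 : ℝ) 1 := by
  induction d with
  | zero => norm_num [extinctionSeq]
  | succ d ih =>
    rw [extinctionSeq]
    constructor <;> nlinarith [ih.1, ih.2]

lemma tendsto_extinctionSeq : Tendsto extinctionSeq atTop (𝓝 1) := by
  have hmono : Monotone extinctionSeq := by
    refine monotone_nat_of_le_succ fun d => ?_
    rw [extinctionSeq]
    linarith [sq_nonneg (extinctionSeq d - 1)]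
  have hbdd : BddAbove (Set.range extinctionSeq) :=
    ⟨1, Set.forall_mem_range.2 fun d => (extinctionSeq_mem_Icc d).2⟩
  have hlim := tendsto_atTop_ciSup hmono hbdd
  set l := ⨆ d, extinctionSeq d
  have hsucc : Tendsto (fun d => extinctionSeq (d + 1)) atTop (𝓝 (1 / 2 + l ^ 2 / 2)) := by
    simp only [extinctionSeq]
    exact ((hlim.pow 2).div_const 2).const_add _
  have hfix := tendsto_nhds_unique hsucc (hlim.comp (tendsto_add_atTop_nat 1))
  have hl : l - 1 = 0 := sq_eq_zero_iff.1 (by linarith)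
  rwa [sub_eq_zero.1 hl] at hlim

section Input

variable {Ω : Type*} [mΩ : MeasurableSpace Ω] {P : Measure Ω} {n : ℕ}
  {ν : ℕ → Vertex → Ω → ℕ} {κ : Vertex → Ω → ℝ} {π : Vertex → Ω → Set ℝ}

namespace IsInput

lemma measurableSet_terminates (h : IsInput P n ν κ π) (d : ℕ) (v : Vertex) :
    MeasurableSet {ω | Terminates (fun v => offspring (fun i u => ν i u ω) v ≠ 2) d v} :=
  Measurable.setOf
    ((measurable_terminates (ν := ν) (κ := κ) (π := π) d v).mono (h.blocksSigma_le _) le_rfl)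

variable [IsProbabilityMeasure P]

lemma ae_offspring_eq_zero_or_two (h : IsInput P n ν κ π) :
    ∀ᵐ ω ∂P, ∀ i v, ν i v ω = 0 ∨ ν i v ω = 2 := by
  refine ae_all_iff.2 fun i => ae_all_iff.2 fun v => ?_
  have h0 : MeasurableSet {ω | ν i v ω = 0} :=
    h.measurable_offspring i v (measurableSet_singleton 0)
  have h2 : MeasurableSet {ω | ν i v ω = 2} :=
    h.measurable_offspring i v (measurableSet_singleton 2)
  have hdisj : Disjoint {ω | ν i v ω = 0} {ω | ν i v ω = 2} :=
    Set.disjoint_left.2 fun ω (h0 : ν i v ω = 0) (h2 : ν i v ω = 2) =>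
      two_ne_zero (h2.symm.trans h0)
  refine (mem_ae_iff_prob_eq_one (h0.union h2)).2 ?_
  rw [measure_union hdisj h2, h.offspring_zero, h.offspring_two, ENNReal.add_halves]

lemma ae_finite_inter_Ioo (h : IsInput P n ν κ π) :
    ∀ᵐ ω ∂P, ∀ v (r : ℕ), (π v ω ∩ Set.Ioo 0 (r : ℝ)).Finite :=
  ae_all_iff.2 fun v => ae_all_iff.2 fun _ =>
    (h.poisson v).ae_finite_inter measurableSet_Ioo Set.Ioo_subset_Ioi_self (by simp)

lemma measure_terminates_succ (h : IsInput P n ν κ π) (d : ℕ) (v : Vertex) :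
    P {ω | Terminates (fun v => offspring (fun i u => ν i u ω) v ≠ 2) (d + 1) v} =
      P {ω | offspring (fun i u => ν i u ω) v ≠ 2} +
        P {ω | Terminates (fun v => offspring (fun i u => ν i u ω) v ≠ 2) d (v ++ [0])} *
        P {ω | Terminates (fun v => offspring (fun i u => ν i u ω) v ≠ 2) d (v ++ [1])} *
        P {ω | offspring (fun i u => ν i u ω) v = 2} := by
  set N : Ω → ℕ := fun ω => offspring (fun i u => ν i u ω) v with hN
  set T : ℕ → Set Ω := fun j =>
    {ω | Terminates (fun v => offspring (fun i u => ν i u ω) v ≠ 2) d (v ++ [j])} with hT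
  have hTm : ∀ j, MeasurableSet[blocksSigma ν κ π (blocksAbove (v ++ [j]))] (T j) := fun j =>
    (@measurableSet_setOfPred _ (blocksSigma ν κ π (blocksAbove (v ++ [j]))) _).2
      (measurable_terminates d (v ++ [j]))
  have hT01 : MeasurableSet[blocksSigma ν κ π (blocksAbove (v ++ [0])) ⊔
      blocksSigma ν κ π (blocksAbove (v ++ [1]))] (T 0 ∩ T 1) :=
    (le_sup_left (a := blocksSigma ν κ π (blocksAbove (v ++ [0]))) _ (hTm 0)).inter
      (le_sup_right (b := blocksSigma ν κ π (blocksAbove (v ++ [1]))) _ (hTm 1))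
  have hNm : MeasurableSet[blocksSigma ν κ π (offspringBlock v)] {ω | N ω = 2} :=
    ForestFire.measurable_offspring v (measurableSet_singleton 2)
  have hsplit : {ω | Terminates (fun v => offspring (fun i u => ν i u ω) v ≠ 2) (d + 1) v} =
      {ω | N ω ≠ 2} ∪ ((T 0 ∩ T 1) ∩ {ω | N ω = 2}) := by
    ext ω
    simp only [Terminates, Set.mem_ofPred_eq, Set.mem_union, Set.mem_inter_iff, hT, hN]
    tauto
  have hdisj : Disjoint {ω | N ω ≠ 2} ((T 0 ∩ T 1) ∩ {ω | N ω = 2}) :=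
    Set.disjoint_left.2 fun ω hne h2 => hne h2.2
  rw [hsplit, measure_union hdisj (((h.measurableSet_terminates d _).inter
    (h.measurableSet_terminates d _)).inter (h.blocksSigma_le _ _ hNm)),
    (Indep_iff _ _ _).1 (h.indep_offspring v) _ _ hT01 hNm,
    (Indep_iff _ _ _).1 (h.indep_children v) _ _ (hTm 0) (hTm 1)]

lemma measure_offspring_planted_ne_two (h : IsInput P n ν κ π) (i : ℕ) (w : Vertex) :
    P {ω | offspring (fun i u => ν i u ω) (spine i ++ 0 :: w) ≠ 2} = 1 / 2 := by
  have hm : MeasurableSet {ω | offspring (fun i u => ν i u ω) (spine i ++ 0 :: w) = 2} := by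
    simp only [offspring_planted]
    exact h.measurable_offspring i w (measurableSet_singleton 2)
  refine (prob_compl_eq_one_sub hm).trans ?_
  rw [h.measure_offspring_planted, one_div, ENNReal.one_sub_inv_two]

lemma measure_terminates_planted (h : IsInput P n ν κ π) (d i : ℕ) (w : Vertex) :
    P {ω | Terminates (fun v => offspring (fun i u => ν i u ω) v ≠ 2) d (spine i ++ 0 :: w)} =
      ENNReal.ofReal (extinctionSeq d) := by
  have hhalf : (1 / 2 : ℝ≥0∞) = ENNReal.ofReal (1 / 2) := by
    rw [ENNReal.ofReal_div_of_pos two_pos, ENNReal.ofReal_one, ENNReal.ofReal_ofNat]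
  induction d generalizing w with
  | zero => exact (h.measure_offspring_planted_ne_two i w).trans hhalf
  | succ d ih =>
    have hpos : 0 ≤ extinctionSeq d := (extinctionSeq_mem_Icc d).1
    simp only [h.measure_terminates_succ, h.measure_offspring_planted_ne_two,
      h.measure_offspring_planted, List.append_assoc, List.cons_append, ih, hhalf]
    rw [← ENNReal.ofReal_mul hpos, ← ENNReal.ofReal_mul (by positivity),
      ← ENNReal.ofReal_add (by positivity) (by positivity), extinctionSeq]
    congr 1
    ring

lemma ae_exists_terminates (h : IsInput P n ν κ π) : ∀ᵐ ω ∂P, ∀ i, ∃ d,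
    Terminates (fun v => offspring (fun i u => ν i u ω) v ≠ 2) d (spine i ++ [0]) := by
  refine ae_all_iff.2 fun i => ?_
  set E : ℕ → Set Ω := fun d =>
    {ω | Terminates (fun v => offspring (fun i u => ν i u ω) v ≠ 2) d (spine i ++ [0])}
  have hm : MeasurableSet (⋃ d, E d) :=
    MeasurableSet.iUnion fun d => h.measurableSet_terminates d _
  have hone : ENNReal.ofReal 1 ≤ P (⋃ d, E d) :=
    le_of_tendsto' (ENNReal.tendsto_ofReal tendsto_extinctionSeq) fun d =>
      (h.measure_terminates_planted d i []).symm.trans_le (measure_mono (Set.subset_iUnion E d))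
  rw [ENNReal.ofReal_one] at hone
  filter_upwards [(mem_ae_iff_prob_eq_one hm).2 (prob_le_one.antisymm hone)] with ω hω
  exact (Set.mem_iUnion (s := E)).1 hω

lemma ae_exists_ownMark (h : IsInput P n ν κ π) (hn : 1 ≤ n) : ∀ᵐ ω ∂P, ∀ i, ∃ j ≥ i,
    PosHits (fun v => κ v ω) (fun v => π v ω) (spine j) [] := by
  refine ae_all_iff.2 fun i => ?_
  set φ : ℝ≥0∞ := ENNReal.ofReal (2 / (2 + (1 : ℕ) / n)) with hφ
  have hφ1 : φ < 1 := by
    have : (0 : ℝ) < (1 : ℕ) / n := by positivity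
    rw [hφ, ← ENNReal.ofReal_one, ENNReal.ofReal_lt_ofReal_iff one_pos, div_lt_one (by positivity)]
    linarith
  have hinj : Function.Injective fun j => spine (i + j) := fun a b hab => by
    simpa only [length_spine, Nat.add_left_cancel_iff] using congrArg List.length hab
  -- `m` backbone vertices all lack an own mark with probability `φ ^ m`.
  have hle : ∀ m : ℕ, P {ω | ¬ ∃ j ≥ i, PosHits (fun v => κ v ω) (fun v => π v ω) (spine j) []} ≤
      φ ^ m := fun m => by
    have hpow := h.measure_forall_not_posHits ((Finset.range m).image fun j => spine (i + j))
      fun _ => {[]}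
    rw [Finset.prod_const, Finset.card_image_of_injective _ hinj, Finset.card_range,
      Finset.card_singleton, ← hφ] at hpow
    rw [← hpow]
    refine measure_mono fun ω hω y hy z hz hit => hω ?_
    obtain ⟨j, -, rfl⟩ := Finset.mem_image.1 hy
    exact ⟨i + j, Nat.le_add_right i j, Finset.mem_singleton.1 hz ▸ hit⟩
  exact le_antisymm
    (ge_of_tendsto' (ENNReal.tendsto_pow_atTop_nhds_zero_of_lt_one hφ1) hle) zero_le

lemma ae_isRegular (h : IsInput P n ν κ π) (hn : 1 ≤ n) :
    ∀ᵐ ω ∂P, IsRegular (fun i v => ν i v ω) (fun v => κ v ω) (fun v => π v ω) := by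
  filter_upwards [h.ae_offspring_eq_zero_or_two, h.ae_length_pos, h.ae_finite_inter_Ioo,
    h.ae_exists_terminates, h.ae_exists_ownMark hn] with ω hν hκ hfin hterm hown
  exact ⟨hν, hκ, hfin, hterm, by rwa [posHits_eq_hits hκ] at hown⟩

end IsInput

end Input

/-! ### The equilibrium equation -/

/-- `p` is a probability on `ℕ` with `r k p_{k+1} = ∑_{i+j=k} p_i p_j`, the equation satisfied by
the number of alive nodes of a planted tree, and by `c_{k+1} / m₀(c)` for an equilibrium `c`. -/
structure IsQuadraticLaw (r p : ℕ → ℝ) : Prop where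
  nonneg : ∀ k, 0 ≤ p k
  hasSum : HasSum p 1
  eqn : ∀ k, r k * p (k + 1) = ∑ x ∈ antidiagonal k, p x.1 * p x.2

/-- `s` is a probability on `ℕ` with `r k s_{k+1} = 2 ∑_{i+j=k} p_i s_j`, the equation satisfied
by the number of alive nodes of the size-biased tree. -/
structure IsLinearLaw (r p s : ℕ → ℝ) : Prop where
  nonneg : ∀ k, 0 ≤ s k
  hasSum : HasSum s 1
  eqn : ∀ k, r k * s (k + 1) = 2 * ∑ x ∈ antidiagonal k, p x.1 * s x.2

lemma eq_of_le_of_hasSum {ι : Type*} {f g : ι → ℝ} {a : ℝ} (h : ∀ i, f i ≤ g i) (hf : HasSum f a)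
    (hg : HasSum g a) : f = g := by
  have hzero : HasSum (g - f) 0 := sub_self a ▸ hg.sub hf
  exact (sub_eq_zero.1 ((hasSum_zero_iff_of_nonneg fun i => sub_nonneg.2 (h i)).1 hzero)).symm

lemma hasSum_succ_iff {M : Type*} [AddCommGroup M] [TopologicalSpace M] [IsTopologicalAddGroup M]
    {f : ℕ → M} (hf : f 0 = 0) {a : M} : HasSum (fun k => f (k + 1)) a ↔ HasSum f a := by
  rw [hasSum_nat_add_iff 1, Finset.sum_range_one, hf, add_zero]

section

variable {r p p' s s' : ℕ → ℝ}

-- The equation makes every `p k` a monotone function of `p 0`, and the total mass fixes `p 0`.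
lemma IsQuadraticLaw.eq_of_le (hr : ∀ k, 0 < r k) (hp : IsQuadraticLaw r p)
    (hp' : IsQuadraticLaw r p') (h : p 0 ≤ p' 0) : p = p' := by
  refine eq_of_le_of_hasSum (fun k => ?_) hp.hasSum hp'.hasSum
  induction k using Nat.strong_induction_on with
  | _ k ih =>
    rcases k with _ | k
    · exact h
    · refine le_of_mul_le_mul_left ?_ (hr k)
      rw [hp.eqn, hp'.eqn]
      refine Finset.sum_le_sum fun x hx => ?_
      exact mul_le_mul (ih _ (Finset.Nat.antidiagonal.fst_lt hx))
        (ih _ (Finset.Nat.antidiagonal.snd_lt hx)) (hp.nonneg _) (hp'.nonneg _)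

lemma IsQuadraticLaw.unique (hr : ∀ k, 0 < r k) (hp : IsQuadraticLaw r p)
    (hp' : IsQuadraticLaw r p') : p = p' :=
  (le_total (p 0) (p' 0)).elim (hp.eq_of_le hr hp') fun h => (hp'.eq_of_le hr hp h).symm

lemma IsLinearLaw.eq_of_le (hr : ∀ k, 0 < r k) (hp : ∀ k, 0 ≤ p k) (hs : IsLinearLaw r p s)
    (hs' : IsLinearLaw r p s') (h : s 0 ≤ s' 0) : s = s' := by
  refine eq_of_le_of_hasSum (fun k => ?_) hs.hasSum hs'.hasSum
  induction k using Nat.strong_induction_on with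
  | _ k ih =>
    rcases k with _ | k
    · exact h
    · refine le_of_mul_le_mul_left ?_ (hr k)
      rw [hs.eqn, hs'.eqn]
      refine mul_le_mul_of_nonneg_left (Finset.sum_le_sum fun x hx => ?_) zero_le_two
      exact mul_le_mul_of_nonneg_left
        (ih _ (Finset.Nat.antidiagonal.snd_lt hx)) (hp _)

lemma IsLinearLaw.unique (hr : ∀ k, 0 < r k) (hp : ∀ k, 0 ≤ p k) (hs : IsLinearLaw r p s)
    (hs' : IsLinearLaw r p s') : s = s' :=
  (le_total (s 0) (s' 0)).elim (hs.eq_of_le hr hp hs') fun h => (hs'.eq_of_le hr hp hs h).symm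

end

lemma two_mul_sum_antidiagonal_mul_succ {R : Type*} [CommRing R] (p : ℕ → R) (k : ℕ) :
    2 * ∑ x ∈ antidiagonal k, p x.1 * ((x.2 + 1) * p x.2) =
      (k + 2) * ∑ x ∈ antidiagonal k, p x.1 * p x.2 := by
  have hswap : ∑ x ∈ antidiagonal k, p x.1 * ((x.2 + 1) * p x.2) =
      ∑ x ∈ antidiagonal k, p x.2 * ((x.1 + 1) * p x.1) :=
    (Finset.Nat.sum_antidiagonal_swap (f := fun x : ℕ × ℕ => p x.1 * ((x.2 + 1) * p x.2))).symm
  rw [two_mul]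
  nth_rewrite 2 [hswap]
  rw [← Finset.sum_add_distrib, Finset.mul_sum]
  refine Finset.sum_congr rfl fun x hx => ?_
  rw [← mem_antidiagonal.1 hx]
  push_cast
  ring

lemma sum_Ico_eq_sum_antidiagonal {R : Type*} [NonUnitalNonAssocSemiring R] (c : ℕ → R) (k : ℕ) :
    ∑ i ∈ Finset.Ico 1 (k + 2), c i * c (k + 2 - i) =
      ∑ x ∈ antidiagonal k, c (x.1 + 1) * c (x.2 + 1) := by
  rw [Finset.Nat.sum_antidiagonal_eq_sum_range_succ (fun i j => c (i + 1) * c (j + 1)),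
    Finset.sum_Ico_eq_sum_range]
  refine Finset.sum_congr rfl fun i hi => ?_
  have hik : k + 2 - (1 + i) = k - i + 1 := by have := Finset.mem_range.1 hi; omega
  rw [hik, add_comm 1 i]

/-- The coefficient `2 + (j - 1) / n` of `c_j` in the equilibrium equation, for `j = k + 2`. -/
noncomputable def lossRate (n k : ℕ) : ℝ := 2 + ((k : ℝ) + 1) / n

lemma lossRate_pos (n k : ℕ) : 0 < lossRate n k := by unfold lossRate; positivity

/-- The sequence `c` with `c_{k+1} = p_k / ∑_j (j + 1) p_j`, which inverts the map sending an
equilibrium `c` to the law `p_k = c_{k+1} / m₀(c)`. -/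
noncomputable def equilibriumOfLaw (p : ℕ → ℝ) : ℕ → ℝ
  | 0 => 0
  | k + 1 => p k / ∑' k : ℕ, ((k : ℝ) + 1) * p k

namespace IsQuadraticLaw

variable {n : ℕ} {p : ℕ → ℝ}

-- `lossRate n k` grows like `k / n`, and the convolution of `p` with itself is summable.
lemma summable_succ_mul (hp : IsQuadraticLaw (lossRate n) p) (hn : 1 ≤ n) :
    Summable fun k : ℕ => ((k : ℝ) + 1) * p k := by
  have hsummable : Summable fun k => lossRate n k * p (k + 1) := by
    simp_rw [hp.eqn]
    exact summable_sum_mul_antidiagonal_of_summable_mul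
      (hp.hasSum.summable.mul_of_nonneg hp.hasSum.summable hp.nonneg hp.nonneg)
  have hn' : (1 : ℝ) ≤ n := by exact_mod_cast hn
  have hrate : ∀ k : ℕ, ((k + 1 : ℕ) : ℝ) + 1 ≤ n * lossRate n k := fun k => by
    have : (n : ℝ) * lossRate n k = 2 * n + (k + 1) := by unfold lossRate; field_simp
    push_cast
    linarith
  rw [← summable_nat_add_iff 1]
  refine Summable.of_nonneg_of_le (fun k => mul_nonneg (by positivity) (hp.nonneg _)) (fun k => ?_)
    (hsummable.mul_left (n : ℝ))
  rw [← mul_assoc]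
  exact mul_le_mul_of_nonneg_right (hrate k) (hp.nonneg _)

lemma tsum_succ_mul_pos (hp : IsQuadraticLaw (lossRate n) p) (hn : 1 ≤ n) :
    0 < ∑' k : ℕ, ((k : ℝ) + 1) * p k :=
  one_pos.trans_le <| hasSum_le
    (fun k => le_mul_of_one_le_left (hp.nonneg k) (le_add_of_nonneg_left k.cast_nonneg))
    hp.hasSum (hp.summable_succ_mul hn).hasSum

lemma hasSum_succ_mul_div (hp : IsQuadraticLaw (lossRate n) p) (hn : 1 ≤ n) :
    HasSum (fun k : ℕ => ((k : ℝ) + 1) * p k / ∑' k : ℕ, ((k : ℝ) + 1) * p k) 1 := by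
  have hdiv := (hp.summable_succ_mul hn).hasSum.div_const (∑' k : ℕ, ((k : ℝ) + 1) * p k)
  rwa [div_self (hp.tsum_succ_mul_pos hn).ne'] at hdiv

lemma isLinearLaw (hp : IsQuadraticLaw (lossRate n) p) (hn : 1 ≤ n) :
    IsLinearLaw (lossRate n) p
      fun k => ((k : ℝ) + 1) * p k / ∑' k : ℕ, ((k : ℝ) + 1) * p k where
  nonneg k := div_nonneg (mul_nonneg (by positivity) (hp.nonneg k)) (hp.tsum_succ_mul_pos hn).le
  hasSum := hp.hasSum_succ_mul_div hn
  eqn k := by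
    have hconv := two_mul_sum_antidiagonal_mul_succ p k
    rw [← hp.eqn k] at hconv
    simp_rw [← mul_div_assoc]
    rw [← Finset.sum_div, ← mul_div_assoc, hconv]
    push_cast
    ring

lemma m₀_equilibriumOfLaw (hp : IsQuadraticLaw (lossRate n) p) :
    m₀ (equilibriumOfLaw p) = 1 / ∑' k : ℕ, ((k : ℝ) + 1) * p k :=
  ((hasSum_succ_iff rfl).1 (hp.hasSum.div_const _)).tsum_eq

lemma isEquilibrium (hp : IsQuadraticLaw (lossRate n) p) (hn : 1 ≤ n) :
    IsEquilibrium n (equilibriumOfLaw p) where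
  zero := rfl
  nonneg
    | 0 => le_rfl
    | k + 1 => div_nonneg (hp.nonneg k) (hp.tsum_succ_mul_pos hn).le
  mass := by
    refine (hasSum_succ_iff (by simp)).1 ((hp.hasSum_succ_mul_div hn).congr_fun fun k => ?_)
    rw [equilibriumOfLaw, Nat.cast_succ, mul_div_assoc]
  eqn k hk := by
    obtain ⟨k, rfl⟩ := Nat.exists_eq_add_of_le' hk
    have hm := hp.tsum_succ_mul_pos hn
    have heqn := hp.eqn k
    rw [sum_Ico_eq_sum_antidiagonal, hp.m₀_equilibriumOfLaw]
    simp only [equilibriumOfLaw, div_mul_div_comm]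
    rw [← Finset.sum_div, ← heqn, lossRate]
    push_cast
    field_simp
    ring

end IsQuadraticLaw

namespace IsEquilibrium

variable {n : ℕ} {c : ℕ → ℝ}

lemma hasSum_m₀ (hc : IsEquilibrium n c) : HasSum c (m₀ c) := by
  refine (Summable.of_nonneg_of_le hc.nonneg (fun k => ?_) hc.mass.summable).hasSum
  rcases k with _ | k
  · simp [hc.zero]
  · exact le_mul_of_one_le_left (hc.nonneg _) (Nat.one_le_cast.2 k.succ_pos)

lemma m₀_pos (hc : IsEquilibrium n c) : 0 < m₀ c := by
  refine (hc.hasSum_m₀.nonneg hc.nonneg).lt_of_ne fun hzero => ?_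
  have hc0 : c = 0 := (hasSum_zero_iff_of_nonneg hc.nonneg).1 (hzero ▸ hc.hasSum_m₀)
  have hmass := hc.mass
  simp only [hc0, Pi.zero_apply, mul_zero] at hmass
  exact zero_ne_one (hasSum_zero.unique hmass)

lemma isQuadraticLaw (hc : IsEquilibrium n c) :
    IsQuadraticLaw (lossRate n) fun k => c (k + 1) / m₀ c where
  nonneg k := div_nonneg (hc.nonneg _) hc.m₀_pos.le
  hasSum := div_self hc.m₀_pos.ne' ▸ ((hasSum_succ_iff hc.zero).2 hc.hasSum_m₀).div_const _
  eqn k := by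
    have hm := hc.m₀_pos
    have heqn := hc.eqn (k + 2) (Nat.le_add_left 2 k)
    rw [sum_Ico_eq_sum_antidiagonal] at heqn
    simp only [div_mul_div_comm]
    rw [← Finset.sum_div, ← mul_div_assoc, div_eq_div_iff hm.ne' (mul_pos hm hm).ne', lossRate]
    push_cast at heqn
    field_simp at heqn ⊢
    linear_combination heqn

lemma eq_equilibriumOfLaw (hc : IsEquilibrium n c) :
    c = equilibriumOfLaw fun k => c (k + 1) / m₀ c := by
  have hmean : ∑' k : ℕ, ((k : ℝ) + 1) * (c (k + 1) / m₀ c) = 1 / m₀ c := by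
    have hmass := (hasSum_succ_iff (by simp)).2 hc.mass
    refine ((hmass.div_const (m₀ c)).congr_fun fun k => ?_).tsum_eq
    rw [Nat.cast_succ, mul_div_assoc]
  funext k
  rcases k with _ | k
  · exact hc.zero
  · rw [equilibriumOfLaw, hmean, div_div_div_cancel_right₀ hc.m₀_pos.ne', div_one]

lemma unique (hc : IsEquilibrium n c) {c' : ℕ → ℝ} (hc' : IsEquilibrium n c') : c = c' := by
  rw [hc.eq_equilibriumOfLaw, hc'.eq_equilibriumOfLaw,
    hc.isQuadraticLaw.unique (lossRate_pos n) hc'.isQuadraticLaw]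

end IsEquilibrium

/-! ### The law of the number of leaves -/

section

variable {Ω β : Type*} [MeasurableSpace Ω] {P : Measure Ω} [MeasurableSpace β]

lemma exists_measurable_eventually_eq [TopologicalSpace β] [DiscreteTopology β] [BorelSpace β]
    [Nonempty β] {X : ℕ → Ω → β} (hX : ∀ d, Measurable (X d))
    (h : ∀ᵐ ω ∂P, ∃ y, ∀ᶠ d in atTop, X d ω = y) :
    ∃ Y : Ω → β, Measurable Y ∧ ∀ᵐ ω ∂P, ∀ᶠ d in atTop, X d ω = Y ω := by
  obtain ⟨Y, hY, hlim⟩ := measurable_limit_of_tendsto_metrizable_ae (L := atTop) (μ := P)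
    (fun d => (hX d).aemeasurable) (h.mono fun ω ⟨y, hy⟩ => ⟨y, tendsto_nhds_of_eventually_eq hy⟩)
  refine ⟨Y, hY, hlim.mono fun ω hω => ?_⟩
  rwa [nhds_discrete, tendsto_pure] at hω

variable [MeasurableSingletonClass β]

lemma tendsto_measureReal_eq [IsFiniteMeasure P] {X : ℕ → Ω → β} (hX : ∀ d, Measurable (X d))
    {Y : Ω → β} (hY : Measurable Y) (h : ∀ᵐ ω ∂P, ∀ᶠ d in atTop, X d ω = Y ω) (b : β) :
    Tendsto (fun d => P.real {ω | X d ω = b}) atTop (𝓝 (P.real {ω | Y ω = b})) := by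
  refine (ENNReal.tendsto_toReal (measure_ne_top _ _)).comp ?_
  refine tendsto_measure_of_ae_tendsto_indicator_of_isFiniteMeasure atTop
    (hY (measurableSet_singleton b)) (fun d => hX d (measurableSet_singleton b)) ?_
  filter_upwards [h] with ω hω
  exact hω.mono fun d hd => Eq.congr_left hd

lemma hasSum_measureReal_eq [Countable β] [IsProbabilityMeasure P] {Y : Ω → β}
    (hY : Measurable Y) : HasSum (fun b => P.real {ω | Y ω = b}) 1 := by
  have hfib := tsum_measure_preimage_singleton (μ := P) (f := Y) Set.countable_univ
    fun b _ => hY (measurableSet_singleton b)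
  rw [tsum_univ fun b => P (Y ⁻¹' {b}), Set.preimage_univ, measure_univ] at hfib
  have hsum := ENNReal.hasSum_toReal (f := fun b => P (Y ⁻¹' {b})) (by simp [hfib])
  rwa [← ENNReal.tsum_toReal_eq fun b => measure_ne_top _ _, hfib] at hsum

end

section Input

variable {Ω : Type*} [mΩ : MeasurableSpace Ω] {P : Measure Ω} [IsProbabilityMeasure P] {n : ℕ}
  {ν : ℕ → Vertex → Ω → ℕ} {κ : Vertex → Ω → ℝ} {π : Vertex → Ω → Set ℝ}

namespace IsInput

lemma ae_eventually_aliveCard_planted_eq (h : IsInput P n ν κ π) :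
    ∀ᵐ ω ∂P, ∃ y, ∀ᶠ d in atTop, aliveCard ν κ π d [0] ω = y := by
  filter_upwards [h.ae_exists_terminates] with ω hω
  obtain ⟨d₀, hd₀⟩ := hω 0
  refine ⟨aliveCard ν κ π d₀ [0] ω, eventually_atTop.2 ⟨d₀, fun d hd => ?_⟩⟩
  exact congrArg Finset.card (alive_eq_of_terminates (hd₀.mono fun v => Or.inl) hd)

lemma ae_finite_and_eventually_ncard_leaves_eq (h : IsInput P n ν κ π) (hn : 1 ≤ n) :
    ∀ᵐ ω ∂P, (prunedTree ν κ π ω).Finite ∧ ∀ᶠ d in atTop,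
      (leaves (prunedTree ν κ π ω)).ncard = aliveCard ν κ π d [] ω + 1 := by
  filter_upwards [h.ae_isRegular hn] with ω hω
  obtain ⟨d₀, hd₀⟩ := hω.exists_terminates
  refine ⟨(hω.finite_prune_and_ncard_leaves hd₀).1, eventually_atTop.2 ⟨d₀, fun d hd => ?_⟩⟩
  rw [aliveCard, posHits_eq_hits hω.length_pos]
  exact (hω.finite_prune_and_ncard_leaves (hd₀.of_le hd)).2

lemma exists_measurable_ncard_leaves_eq (h : IsInput P n ν κ π) (hn : 1 ≤ n) :
    ∃ Z : Ω → ℕ, Measurable Z ∧ (∀ᵐ ω ∂P, ∀ᶠ d in atTop, aliveCard ν κ π d [] ω = Z ω) ∧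
      ∀ᵐ ω ∂P, (leaves (prunedTree ν κ π ω)).ncard = Z ω + 1 := by
  have hleaves := h.ae_finite_and_eventually_ncard_leaves_eq hn
  obtain ⟨Z, hZ, hlim⟩ := exists_measurable_eventually_eq (P := P)
    (fun d => h.measurable_aliveCard d []) <| hleaves.mono fun ω hω =>
      ⟨(leaves (prunedTree ν κ π ω)).ncard - 1, hω.2.mono fun d hd => by omega⟩
  refine ⟨Z, hZ, hlim, ?_⟩
  filter_upwards [hleaves, hlim] with ω hω hZω
  obtain ⟨d, hd, hZd⟩ := (hω.2.and hZω).exists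
  rw [hd, hZd]

lemma lossRate_mul_aliveCard_planted (h : IsInput P n ν κ π) (d k : ℕ) :
    lossRate n k * P.real {ω | aliveCard ν κ π (d + 1) [0] ω = k + 1} =
      ∑ x ∈ antidiagonal k, P.real {ω | aliveCard ν κ π d [0] ω = x.1} *
        P.real {ω | aliveCard ν κ π d [0] ω = x.2} := by
  have hpos := lossRate_pos n k
  rw [measureReal_def, h.measure_aliveCard_planted_succ, ENNReal.toReal_mul, ENNReal.toReal_mul,
    ENNReal.toReal_ofReal (by positivity), ENNReal.toReal_sum
      fun x _ => ENNReal.mul_ne_top (measure_ne_top _ _) (measure_ne_top _ _)]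
  simp only [ENNReal.toReal_mul, ENNReal.toReal_div, ENNReal.toReal_one, ENNReal.toReal_ofNat,
    ← measureReal_def, lossRate] at hpos ⊢
  push_cast
  field_simp

lemma lossRate_mul_aliveCard_spine (h : IsInput P n ν κ π) (d k : ℕ) :
    lossRate n k * P.real {ω | aliveCard ν κ π (d + 1) [] ω = k + 1} =
      2 * ∑ x ∈ antidiagonal k, P.real {ω | aliveCard ν κ π d [0] ω = x.1} *
        P.real {ω | aliveCard ν κ π d [] ω = x.2} := by
  have hpos := lossRate_pos n k
  rw [measureReal_def, h.measure_aliveCard_spine_succ, ENNReal.toReal_mul,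
    ENNReal.toReal_ofReal (by positivity), ENNReal.toReal_sum
      fun x _ => ENNReal.mul_ne_top (measure_ne_top _ _) (measure_ne_top _ _)]
  simp only [ENNReal.toReal_mul, ← measureReal_def, lossRate] at hpos ⊢
  push_cast
  field_simp

lemma exists_isQuadraticLaw_tendsto (h : IsInput P n ν κ π) :
    ∃ p, IsQuadraticLaw (lossRate n) p ∧
      ∀ k, Tendsto (fun d => P.real {ω | aliveCard ν κ π d [0] ω = k}) atTop (𝓝 (p k)) := by
  obtain ⟨Y, hY, hYlim⟩ := exists_measurable_eventually_eq
    (fun d => h.measurable_aliveCard d [0]) h.ae_eventually_aliveCard_planted_eq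
  have hlim := tendsto_measureReal_eq (fun d => h.measurable_aliveCard d [0]) hY hYlim
  refine ⟨_, ⟨fun k => measureReal_nonneg, hasSum_measureReal_eq hY, fun k => ?_⟩, hlim⟩
  refine tendsto_nhds_unique
    (((hlim (k + 1)).comp (tendsto_add_atTop_nat 1)).const_mul (lossRate n k)) ?_
  exact Tendsto.congr (fun d => (h.lossRate_mul_aliveCard_planted d k).symm)
    (tendsto_finsetSum _ fun x _ => (hlim x.1).mul (hlim x.2))

lemma isLinearLaw (h : IsInput P n ν κ π) {p : ℕ → ℝ} {Z : Ω → ℕ} (hZ : Measurable Z)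
    (hp : ∀ k, Tendsto (fun d => P.real {ω | aliveCard ν κ π d [0] ω = k}) atTop (𝓝 (p k)))
    (hZlim : ∀ᵐ ω ∂P, ∀ᶠ d in atTop, aliveCard ν κ π d [] ω = Z ω) :
    IsLinearLaw (lossRate n) p fun k => P.real {ω | Z ω = k} := by
  have hlim := tendsto_measureReal_eq (fun d => h.measurable_aliveCard d []) hZ hZlim
  refine ⟨fun k => measureReal_nonneg, hasSum_measureReal_eq hZ, fun k => ?_⟩
  refine tendsto_nhds_unique
    (((hlim (k + 1)).comp (tendsto_add_atTop_nat 1)).const_mul (lossRate n k)) ?_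
  exact Tendsto.congr (fun d => (h.lossRate_mul_aliveCard_spine d k).symm)
    ((tendsto_finsetSum _ fun x _ => (hp x.1).mul (hlim x.2)).const_mul 2)

lemma aemeasurable_ncard_leaves (h : IsInput P n ν κ π) (hn : 1 ≤ n) :
    AEMeasurable (fun ω => (leaves (prunedTree ν κ π ω)).ncard) P := by
  obtain ⟨Z, hZ, -, hleaves⟩ := h.exists_measurable_ncard_leaves_eq hn
  exact (hZ.add_const 1).aemeasurable.congr (hleaves.mono fun ω hω => hω.symm)

theorem measure_ncard_leaves_eq (h : IsInput P n ν κ π) (hn : 1 ≤ n) {c : ℕ → ℝ}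
    (hc : IsEquilibrium n c) {k : ℕ} (hk : 1 ≤ k) :
    P {ω | (leaves (prunedTree ν κ π ω)).ncard = k} = ENNReal.ofReal (k * c k) := by
  obtain ⟨k, rfl⟩ := Nat.exists_eq_add_of_le' hk
  obtain ⟨p, hp, hlim⟩ := h.exists_isQuadraticLaw_tendsto
  obtain ⟨Z, hZ, hZlim, hleaves⟩ := h.exists_measurable_ncard_leaves_eq hn
  have hset : P {ω | (leaves (prunedTree ν κ π ω)).ncard = k + 1} = P {ω | Z ω = k} :=
    measure_congr <| hleaves.mono fun ω hω => propext <|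
      show (leaves (prunedTree ν κ π ω)).ncard = k + 1 ↔ Z ω = k by omega
  have hlaw := congrFun ((h.isLinearLaw hZ hlim hZlim).unique (lossRate_pos n) hp.nonneg
    (hp.isLinearLaw hn)) k
  rw [hset, ← ofReal_measureReal, hlaw, hc.unique (hp.isEquilibrium hn), equilibriumOfLaw,
    mul_div_assoc, Nat.cast_succ]

end IsInput

end Input

lemma hasOwnMark_iff {Ω : Type*} {κ : Vertex → Ω → ℝ} {π : Vertex → Ω → Set ℝ} {ω : Ω} {j : ℕ} :
    HasOwnMark κ π ω j ↔ Hits (fun v => κ v ω) (fun v => π v ω) (spine j) [] :=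
  (hits_nil_iff (π := fun v => π v ω)).symm

end ForestFire

theorem mainTheorem5 {Ω : Type*} [MeasurableSpace Ω] (P : MeasureTheory.Measure Ω)
    [MeasureTheory.IsProbabilityMeasure P] (n : ℕ) (hn : 1 ≤ n)
    (ν : ℕ → ForestFire.Vertex → Ω → ℕ) (κ : ForestFire.Vertex → Ω → ℝ)
    (π : ForestFire.Vertex → Ω → Set ℝ) (hinput : ForestFire.IsInput P n ν κ π) :
    -- the pruning procedure is a.s. well defined on the infinite tree
    (∀ᵐ ω ∂P, ForestFire.PruningWellDefined (ForestFire.sizeBiasedTree ν ω)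
      (fun v => κ v ω) (fun v => π v ω)) ∧
    -- the pruned tree is a.s. finite
    (∀ᵐ ω ∂P, (ForestFire.prunedTree ν κ π ω).Finite) ∧
    -- perfect simulation: some backbone edge a.s. carries a mark sent by its upper endpoint, and
    -- pruning the finite tree in which this endpoint is made a leaf yields the same pruned tree
    (∀ᵐ ω ∂P, (∃ j, ForestFire.HasOwnMark κ π ω j) ∧
      ∀ j, ForestFire.HasOwnMark κ π ω j →
        (ForestFire.truncate (ForestFire.sizeBiasedTree ν ω) (ForestFire.spine j)).Finite ∧
        ForestFire.PruningWellDefined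
          (ForestFire.truncate (ForestFire.sizeBiasedTree ν ω) (ForestFire.spine j))
          (fun v => κ v ω) (fun v => π v ω) ∧
        ForestFire.prunedTree ν κ π ω =
          ForestFire.prune
            (ForestFire.truncate (ForestFire.sizeBiasedTree ν ω) (ForestFire.spine j))
            (fun v => κ v ω) (fun v => π v ω)) ∧
    -- the number of leaves of the pruned tree has law `(k c_k)_{k ≥ 1}`, where `c` is the
    -- equilibrium
    AEMeasurable (fun ω => (ForestFire.leaves (ForestFire.prunedTree ν κ π ω)).ncard) P ∧
    ∃ c : ℕ → ℝ, ForestFire.IsEquilibrium n c ∧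
      (∀ c' : ℕ → ℝ, ForestFire.IsEquilibrium n c' → c' = c) ∧
      ∀ k : ℕ, 1 ≤ k →
        P {ω | (ForestFire.leaves (ForestFire.prunedTree ν κ π ω)).ncard = k} =
          ENNReal.ofReal (k * c k) := by
  obtain ⟨p, hp, -⟩ := hinput.exists_isQuadraticLaw_tendsto
  have hc := hp.isEquilibrium hn
  have hreg := hinput.ae_isRegular hn
  refine ⟨hreg.mono fun ω hω => hω.pruningWellDefined,
    (hinput.ae_finite_and_eventually_ncard_leaves_eq hn).mono fun ω hω => hω.1,
    hreg.mono fun ω hω => ⟨?_, fun j hj => ⟨hω.finite_truncate j, hω.pruningWellDefined_truncate j,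
      (hω.prune_truncate (ForestFire.hasOwnMark_iff.1 hj)).symm⟩⟩,
    hinput.aemeasurable_ncard_leaves hn, ForestFire.equilibriumOfLaw p, hc,
    fun c' hc' => hc'.unique hc, fun k hk => hinput.measure_ncard_leaves_eq hn hc hk⟩
  obtain ⟨j, -, hj⟩ := hω.own_mark 0
  exact ⟨j, ForestFire.hasOwnMark_iff.2 hj⟩
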